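/- Consider a horizontally layered medium in $\mathbb R^3$ with coordinates $(x,y,z)$, $z$ vertical: there are finitely many interfaces $z=d_k$, and the complex conductivity $\sigma_b(z)$ is constant in each layer, with $\operatorname{Re}\sigma_b\ge 0$. Let $\omega\neq 0$ and $\mu_0>0$. Let $\widehat G^E(M,M_0)$, $M=(x,y,z)$, $M_0=(x_0,y_0,z_0)$, be the electric Green's tensor of the medium, i.e. the $3\times3$ matrix kernel of the operator $J\mapsto E$ that sends a square integrable, compactly supported current $J$ to the electric field of the solution of $$\operatorname{curl}H=\sigma_b(z)E+J,\qquad \operatorname{curl}E=i\omega\mu_0H$$ satisfying the condition at infinity: $E(M)=\int \widehat G^E(M,M_0)J(M_0)\,dM_0$ for $M$ outside the support of $J$, the kernel being continuous off the diagonal and off the interfaces. The condition at infinity is $E,H\in L^2(\mathbb R^3)$ if $\operatorname{Re}\sigma_b>0$ in every layer; otherwise it is the limiting absorption principle: $\widehat G^E$ is the pointwise limit, as $\varepsilon\to0^+$, of the Green's tensors for $\sigma_b+\varepsilon$. Suppose that such a $\widehat G^E$ exists. Then, for all $M\ne M_0$ with neither $z$ nor $z_0$ on an interface and with $\sigma_b(z),\sigma_b(z_0)$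 not both zero, $\widehat G^E(M,M_0)$ depends only on $(x-x_0,\,y-y_0,\,z,\,z_0)$, and its components satisfy $$\begin{aligned} G^E_{\alpha\alpha}(x-x_0,y-y_0,z,z_0)&=G^E_{\alpha\alpha}(x-x_0,y-y_0,z_0,z),\quad \alpha\in\{x,y,z\},\\ G^E_{xy}(x-x_0,y-y_0,z,z_0)&=G^E_{yx}(x-x_0,y-y_0,z,z_0),\\ G^E_{xy}(x-x_0,y-y_0,z,z_0)&=G^E_{xy}(x-x_0,y-y_0,z_0,z),\\ G^E_{zx}(x-x_0,y-y_0,z,z_0)&=-G^E_{xz}(x-x_0,y-y_0,z_0,z),\\ G^E_{zy}(x-x_0,y-y_0,z,z_0)&=-G^E_{yz}(x-x_0,y-y_0,z_0,z). \end{aligned}$$ Consequently, let a rectangular domain be divided into $N_xN_yN_z$ boxes $\Omega_n$, all of the same lateral size $h_x\times h_y$ and with arbitrary vertical nodes; write $(I^n_x,I^n_y,I^n_z)$ for the position of $\Omega_n$ in the grid. Let $\widehat B_n^m=\int_{\Omega_n}\int_{\Omega_m}\widehat G^E(M,M_0)\,dM_0\,dM$ be the $3\times3$ blocks of the Galerkin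 matrix. Here the inner integral is understood as the operator $J\mapsto E$ above applied to the three unit currents supported in $\Omega_m$ (the kernel is not absolutely integrable when $n=m$), and, if $\operatorname{Re}\sigma_b$ vanishes in some layer, $\widehat B_n^m$ is the limit as $\varepsilon\to0^+$ of the corresponding matrices for $\sigma_b+\varepsilon$, which is assumed to exist. Then there are $N_z\times N_z$ matrices $Q_{\alpha\beta}(i,j)$, $\alpha,\beta\in\{x,y,z\}$, such that the $(\alpha,\beta)$ entry of $\widehat B_n^m$ is the $(I^n_z,I^m_z)$ entry of $Q_{\alpha\beta}(I^n_y-I^m_y,\,I^n_x-I^m_x)$, and for all integers $|i|<N_y$, $|j|<N_x$, at $(i,j)$, $$Q_{zx}=-Q_{xz}^T,\quad Q_{zy}=-Q_{yz}^T,\quad Q_{xx}=Q_{xx}^T,\quad Q_{yy}=Q_{yy}^T,\quad Q_{zz}=Q_{zz}^T,\quad Q_{xy}=Q_{xy}^T=Q_{yx}=Q_{yx}^T.$$ -/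

import Mathlib

open MeasureTheory Filter Topology

noncomputable section

namespace LayeredEM

/-- Physical space; the coordinates `0, 1, 2` are `x, y, z`, with `z` vertical. -/
abbrev Space : Type := EuclideanSpace ℝ (Fin 3)

/-- Values of complex vector fields. -/
abbrev CVec : Type := EuclideanSpace ℂ (Fin 3)

/-- Complex `3 × 3` tensors in Cartesian coordinates. -/
abbrev Tensor : Type := Matrix (Fin 3) (Fin 3) ℂ

/-! ### Horizontally layered media -/

/-- A horizontally layered medium: finitely many (possibly no) horizontal interfaces, and a
complex conductivity with nonnegative real part in each of the layers between them. -/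
structure LayeredMedium where
  numInterfaces : ℕ
  interface : Fin numInterfaces → ℝ
  strictMono_interface : StrictMono interface
  layerConductivity : Fin (numInterfaces + 1) → ℂ
  re_nonneg : ∀ k, 0 ≤ (layerConductivity k).re

/-- The layer that contains height `z`: the number of interfaces strictly below `z`. -/
def LayeredMedium.layerOf (L : LayeredMedium) (z : ℝ) : Fin (L.numInterfaces + 1) :=
  ⟨(Finset.univ.filter fun k => L.interface k < z).card,
    Nat.lt_succ_of_le ((Finset.card_filter_le _ _).trans (by simp))⟩

/-- The piecewise constant conductivity profile `σ_b(z)`. -/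
def LayeredMedium.conductivity (L : LayeredMedium) (z : ℝ) : ℂ :=
  L.layerConductivity (L.layerOf z)

/-- The heights of the interfaces. -/
def LayeredMedium.interfaces (L : LayeredMedium) : Set ℝ := Set.range L.interface

/-- Every layer is dissipative. -/
def LayeredMedium.IsLossy (L : LayeredMedium) : Prop := ∀ k, 0 < (L.layerConductivity k).re

/-- Two points off the diagonal `P = P₀` and off the interfaces of the medium. -/
def OffDiagonal (S : Set ℝ) (P P₀ : Space) : Prop := P ≠ P₀ ∧ P 2 ∉ S ∧ P₀ 2 ∉ S

/-- The pairs of points at which the Green's tensor of the medium has a value: distinct points,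
off the interfaces, and not both in perfectly insulating layers.  (A dipole inside a layer with
`σ = 0` has no finite electric field in that layer.  In a lossy medium the last condition is
always true.) -/
def LayeredMedium.RegularPair (L : LayeredMedium) (P P₀ : Space) : Prop :=
  OffDiagonal L.interfaces P P₀ ∧ (L.conductivity (P 2) ≠ 0 ∨ L.conductivity (P₀ 2) ≠ 0)

/-! ### Maxwell's equations -/

/-- `pderiv φ j k P` is the partial derivative `∂_j φ_k` at `P`. -/
def pderiv (φ : Space → CVec) (j k : Fin 3) (P : Space) : ℂ :=
  (fderiv ℝ φ P (EuclideanSpace.single j 1)) k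

/-- The classical curl. -/
def curl (φ : Space → CVec) (P : Space) : CVec :=
  !₂[pderiv φ 1 2 P - pderiv φ 2 1 P,
     pderiv φ 2 0 P - pderiv φ 0 2 P,
     pderiv φ 0 1 P - pderiv φ 1 0 P]

/-- `curl U = V` in the sense of distributions. -/
def HasWeakCurl (U V : Space → CVec) : Prop :=
  ∀ φ : Space → CVec, ContDiff ℝ (⊤ : ℕ∞) φ → HasCompactSupport φ →
    ∫ P, ∑ α, U P α * curl φ P α = ∫ P, ∑ α, V P α * φ P α

/-- `(E, H)` is a square integrable solution of `curl H = σ(z) E + J`, `curl E = i ω μ₀ H`.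
When `Re σ` is bounded below by a positive constant, square integrability is the condition at
infinity that makes the solution unique. -/
def IsFiniteEnergyField (σ : ℝ → ℂ) (ω μ₀ : ℝ) (J E H : Space → CVec) : Prop :=
  MemLp E 2 ∧ MemLp H 2 ∧
  HasWeakCurl H (fun P => σ (P 2) • E P + J P) ∧
  HasWeakCurl E (fun P => (Complex.I * ω * μ₀) • H P)

/-! ### The electric Green's tensor -/

/-- `G` is the electric Green's tensor of a lossy profile `σ` with interfaces `S`: it is
continuous off the diagonal and off the interfaces, and for every square integrable, compactly
supported current `J` the electric field excited by `J` is `E(P) = ∫ G(P, P₀) J(P₀) dP₀` outside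
the support of `J` (where this is not a singular integral). -/
def IsLossyGreenTensor (σ : ℝ → ℂ) (S : Set ℝ) (ω μ₀ : ℝ) (G : Space → Space → Tensor) : Prop :=
  ContinuousOn (fun p : Space × Space => G p.1 p.2) {p | OffDiagonal S p.1 p.2} ∧
  ∀ J : Space → CVec, MemLp J 2 → HasCompactSupport J →
    ∃ E H : Space → CVec, IsFiniteEnergyField σ ω μ₀ J E H ∧
      ∀ᵐ P, P ∉ tsupport J → ∀ α,
        Integrable (fun P₀ => ∑ β, G P P₀ α β * J P₀ β) ∧
        E P α = ∫ P₀, ∑ β, G P P₀ α β * J P₀ β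

/-- `G` is the electric Green's tensor of the layered medium `L`.  If all layers are dissipative,
it is the kernel of the finite energy solution operator.  If some layer is not dissipative
(a vacuum or a lossless dielectric, say), the condition at infinity is the limiting absorption
principle: `G` is the limit, as `ε → 0+`, of the Green's tensors of the media with conductivity
`σ_b + ε`. -/
def LayeredMedium.IsElectricGreenTensor (L : LayeredMedium) (ω μ₀ : ℝ)
    (G : Space → Space → Tensor) : Prop :=
  (L.IsLossy → IsLossyGreenTensor L.conductivity L.interfaces ω μ₀ G) ∧
  (¬ L.IsLossy → ∃ Gε : ℝ → Space → Space → Tensor,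
    (∀ ε : ℝ, 0 < ε → IsLossyGreenTensor (fun z => L.conductivity z + (ε : ℂ)) L.interfaces ω μ₀ (Gε ε)) ∧
    ∀ P P₀, L.RegularPair P P₀ →
      Tendsto (fun ε => Gε ε P P₀) (𝓝[>] 0) (𝓝 (G P P₀)))

/-- The tensor as a function of the lateral offsets `ξ, η` and the two heights `z, z₀`
(the receiver is at height `z`, the source at height `z₀`). -/
def lateralForm (G : Space → Space → Tensor) (ξ η z z₀ : ℝ) : Tensor :=
  G !₂[ξ, η, z] !₂[0, 0, z₀]

/-! ### The Galerkin matrix -/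

/-- A rectangular domain divided into `Nx * Ny * Nz` boxes of the same lateral size `hx × hy`,
with arbitrary vertical nodes. -/
structure Grid (Nx Ny Nz : ℕ) where
  x₀ : ℝ
  y₀ : ℝ
  hx : ℝ
  hy : ℝ
  hx_pos : 0 < hx
  hy_pos : 0 < hy
  node : Fin (Nz + 1) → ℝ
  strictMono_node : StrictMono node

/-- Index `(I_x, I_y, I_z)` of a box (counted from `0`). -/
abbrev CellIndex (Nx Ny Nz : ℕ) : Type := Fin Nx × Fin Ny × Fin Nz

/-- The box `Ω_n`. -/
def Grid.cell {Nx Ny Nz : ℕ} (g : Grid Nx Ny Nz) (n : CellIndex Nx Ny Nz) : Set Space :=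
  {P | P 0 ∈ Set.Ico (g.x₀ + g.hx * (n.1 : ℕ)) (g.x₀ + g.hx * ((n.1 : ℕ) + 1)) ∧
       P 1 ∈ Set.Ico (g.y₀ + g.hy * (n.2.1 : ℕ)) (g.y₀ + g.hy * ((n.2.1 : ℕ) + 1)) ∧
       P 2 ∈ Set.Ico (g.node n.2.2.castSucc) (g.node n.2.2.succ)}

/-- The current equal to the `β`-th unit vector in `Ω_m` and zero outside. -/
def Grid.unitCurrent {Nx Ny Nz : ℕ} (g : Grid Nx Ny Nz) (m : CellIndex Nx Ny Nz) (β : Fin 3) :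
    Space → CVec :=
  (g.cell m).indicator fun _ => EuclideanSpace.single β 1

/-- `B n m` is the `3 × 3` matrix `∫_{Ω_n} ∫_{Ω_m} G(P, P₀) dP₀ dP` for a lossy profile `σ`.
The kernel is not absolutely integrable when `n = m`, so the inner integral is the Green's
operator (the finite energy solution operator) applied to the unit currents in `Ω_m`; outside
`Ω_m` its value is the integral of the kernel `G` over `Ω_m`. -/
def IsLossyGalerkinMatrix (σ : ℝ → ℂ) (ω μ₀ : ℝ) {Nx Ny Nz : ℕ} (g : Grid Nx Ny Nz)
    (B : CellIndex Nx Ny Nz → CellIndex Nx Ny Nz → Tensor) : Prop :=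
  ∀ m β, ∃ E H : Space → CVec, IsFiniteEnergyField σ ω μ₀ (g.unitCurrent m β) E H ∧
    ∀ n α, B n m α β = ∫ P in g.cell n, E P α

/-- `B` is the matrix of double integrals of the Green's tensor of `L` over the boxes of the grid
(by limiting absorption if some layer is not dissipative). -/
def LayeredMedium.IsGalerkinMatrix (L : LayeredMedium) (ω μ₀ : ℝ) {Nx Ny Nz : ℕ}
    (g : Grid Nx Ny Nz) (B : CellIndex Nx Ny Nz → CellIndex Nx Ny Nz → Tensor) : Prop :=
  (L.IsLossy → IsLossyGalerkinMatrix L.conductivity ω μ₀ g B) ∧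
  (¬ L.IsLossy → ∃ Bε : ℝ → CellIndex Nx Ny Nz → CellIndex Nx Ny Nz → Tensor,
    (∀ ε : ℝ, 0 < ε → IsLossyGalerkinMatrix (fun z => L.conductivity z + (ε : ℂ)) ω μ₀ g (Bε ε)) ∧
    ∀ n m, Tendsto (fun ε => Bε ε n m) (𝓝[>] 0) (𝓝 (B n m)))

/-- `Q i j α β` are the `Nz × Nz` blocks of `B`, where `i` is the offset of the boxes in the `y`
direction and `j` the offset in the `x` direction. -/
def IsBlockForm {Nx Ny Nz : ℕ} (B : CellIndex Nx Ny Nz → CellIndex Nx Ny Nz → Tensor)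
    (Q : ℤ → ℤ → Fin 3 → Fin 3 → Matrix (Fin Nz) (Fin Nz) ℂ) : Prop :=
  ∀ n m α β, B n m α β =
    Q (((n.2.1 : ℕ) : ℤ) - ((m.2.1 : ℕ) : ℤ)) (((n.1 : ℕ) : ℤ) - ((m.1 : ℕ) : ℤ))
      α β n.2.2 m.2.2

end LayeredEM

end

open LayeredEM

noncomputable section

namespace LayeredEM

open scoped Convolution
open ContinuousLinearMap (lsmul)

/-! ### Pairings of square integrable fields -/

/-! The symmetries come from two facts about a dissipative medium: the finite energy field of a
given current is unique, and the medium does not change under reflections in vertical planes. Both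
uniqueness and Lorentz reciprocity follow from one integration by parts,
`integral_pairing_weakCurl`: if `curl U = V` and `curl F = K` weakly, all in `L²`, then `∫ U·K = ∫
V·F`. Pairing `H` with the conjugate of `E` gives the energy identity and hence uniqueness; pairing
two solutions gives reciprocity.

A mirror image of a solution is again a solution, with the sign of `H` reversed, so by uniqueness
the response commutes with every vertical mirror (`IsResponse.reflect`). Two parallel mirrors
compose to a translation, which makes the kernel depend on lateral offsets only. Two perpendicular
mirrors compose to a half-turn; placed midway between the points and combined with reciprocity, it
exchanges the two heights, with a sign exactly when one index is vertical. The mirror in a vertical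
plane through both points gives `G_xy = G_yx`.

Everything is phrased for averaged responses between two regions. Shrinking balls turn these into
pointwise identities for the kernel (`IsLossyGreenTensor.exists_tendsto_response`); grid boxes turn
them into identities for the Galerkin blocks. Only the `xy` symmetry of the blocks needs the kernel
itself, because a mirror through two points need not preserve boxes. Media with a non-dissipative
layer follow by letting `ε → 0+` in each identity. -/

lemma memLp_apply {U : Space → CVec} (hU : MemLp U 2) (α : Fin 3) :
    MemLp (fun P => U P α) 2 :=
  (EuclideanSpace.proj (𝕜 := ℂ) α).comp_memLp' hU

lemma memLp_of_apply {U : Space → CVec} (hU : ∀ α, MemLp (fun P => U P α) 2) : MemLp U 2 :=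
  MemLp.of_eval_piLp hU

lemma integrable_pairing {U V : Space → CVec} (hU : MemLp U 2) (hV : MemLp V 2) :
    Integrable (fun P => ∑ α, U P α * V P α) :=
  integrable_finsetSum _ fun α _ => (memLp_apply hU α).integrable_mul (memLp_apply hV α)

/-! ### Mollification in a pairing -/

/-- Translations act continuously on `L²`, and the correlation is an inner product with a translate.
-/
lemma continuous_integral_mul_translate {u w : Space → ℂ} (hu : MemLp u 2) (hw : MemLp w 2) :
    Continuous fun t : Space => ∫ x, u x * w (x + t) := by
  have hmp : ∀ t : Space, MeasurePreserving (fun x : Space => x + t) :=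
    fun t => measurePreserving_add_right volume t
  let g : C(Space, C(Space, Space)) :=
    (ContinuousMap.mk (fun a : Space × Space => a.2 + a.1) (by fun_prop)).curry
  have hg : ∀ t, MeasurePreserving (g t) (volume : Measure Space) volume := hmp
  have hc : Continuous fun t => Lp.compMeasurePreserving (g t) (hg t) (hw.toLp w) :=
    continuous_const.compMeasurePreservingLp g.continuous hg (by norm_num)
  -- The inner product conjugates its first slot, hence `star u`.
  have h2 : Continuous fun t => inner ℂ (hu.star.toLp (star u))
      (Lp.compMeasurePreserving (g t) (hg t) (hw.toLp w)) := by fun_prop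
  refine h2.congr fun t => ?_
  rw [L2.inner_def]
  refine integral_congr_ae ?_
  have h3 := Lp.coeFn_compMeasurePreserving (hw.toLp w) (hg t)
  have h4 := (hg t).quasiMeasurePreserving.ae_eq_comp hw.coeFn_toLp
  filter_upwards [h3, h4, hu.star.coeFn_toLp] with x e3 e4 e5
  rw [e3, e4, e5]
  simp [g, mul_comm]

/-- Domination by `|ρ(t)| (|u(x)|² + |w(x - t)|²)`, from `2ab ≤ a² + b²`. This is the hypothesis of
Fubini below. -/
lemma integrable_mul_convolution_integrand {u w : Space → ℂ} {ρ : Space → ℝ} (hu : MemLp u 2)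
    (hw : MemLp w 2) (hρ : Integrable ρ) :
    Integrable (fun p : Space × Space => u p.1 * (ρ p.2 • w (p.1 - p.2)))
      (volume.prod volume) := by
  have hu2 : Integrable fun x => ‖u x‖ ^ 2 := hu.integrable_norm_pow (by norm_num)
  have hw2 : Integrable fun x => ‖w x‖ ^ 2 := hw.integrable_norm_pow (by norm_num)
  have h1 := hu2.mul_prod hρ.norm
  have h2 := Integrable.convolution_integrand (lsmul ℝ ℝ) hρ.norm hw2
  refine (h1.add h2).mono' ?_ (ae_of_all _ fun p => ?_)
  · exact hu.1.comp_fst.mul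
      (AEStronglyMeasurable.convolution_integrand (lsmul ℝ ℝ) hρ.1 hw.1)
  · simp only [norm_mul, norm_smul, Pi.add_apply, ContinuousLinearMap.lsmul_apply, smul_eq_mul]
    nlinarith [norm_nonneg (ρ p.2), mul_nonneg (norm_nonneg (ρ p.2))
      (sq_nonneg (‖u p.1‖ - ‖w (p.1 - p.2)‖)), mul_nonneg (norm_nonneg (ρ p.2))
      (add_nonneg (sq_nonneg ‖u p.1‖) (sq_nonneg ‖w (p.1 - p.2)‖))]

/-- By Fubini, mollifying one factor of a pairing amounts to mollifying the correlation function and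
evaluating it at `0`. -/
lemma integral_mul_convolution {u w : Space → ℂ} {ρ : Space → ℝ} (hu : MemLp u 2)
    (hw : MemLp w 2) (hρ : Integrable ρ) :
    ∫ x, u x * (ρ ⋆[lsmul ℝ ℝ] w) x =
      (ρ ⋆[lsmul ℝ ℝ] fun t => ∫ x, u x * w (x + t)) 0 := by
  have hI := integrable_mul_convolution_integrand hu hw hρ
  calc ∫ x, u x * (ρ ⋆[lsmul ℝ ℝ] w) x
      = ∫ x, ∫ t, u x * (ρ t • w (x - t)) := by
        refine integral_congr_ae (ae_of_all _ fun x => ?_)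
        simp only [convolution, ContinuousLinearMap.lsmul_apply]
        rw [integral_const_mul]
    _ = ∫ t, ∫ x, u x * (ρ t • w (x - t)) := integral_integral_swap hI
    _ = _ := by
        refine integral_congr_ae (ae_of_all _ fun t => ?_)
        simp only [ContinuousLinearMap.lsmul_apply, zero_sub, mul_smul_comm, ← sub_eq_add_neg]
        rw [integral_smul]

/-- An approximate identity converges pointwise on the continuous correlation function. Weak
convergence of mollifications is all that the integration by parts needs. -/
lemma tendsto_integral_mul_mollify {u w : Space → ℂ} (hu : MemLp u 2) (hw : MemLp w 2)
    {φ : ℕ → ContDiffBump (0 : Space)} (hφ : Tendsto (fun n => (φ n).rOut) atTop (𝓝 0)) :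
    Tendsto (fun n => ∫ x, u x * ((φ n).normed volume ⋆[lsmul ℝ ℝ] w) x) atTop
      (𝓝 (∫ x, u x * w x)) := by
  have h := ContDiffBump.convolution_tendsto_right_of_continuous (μ := volume) hφ
    (continuous_integral_mul_translate hu hw) 0
  simp only [add_zero] at h
  refine h.congr fun n => ?_
  rw [integral_mul_convolution hu hw (φ n).integrable_normed]

lemma integrable_mul_convolution {u w : Space → ℂ} {ρ : Space → ℝ} (hu : MemLp u 2)
    (hw : MemLp w 2) (hρ : Integrable ρ) :
    Integrable fun x => u x * (ρ ⋆[lsmul ℝ ℝ] w) x := by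
  refine (integrable_mul_convolution_integrand hu hw hρ).integral_prod_left.congr
    (ae_of_all _ fun x => ?_)
  simp only [convolution, ContinuousLinearMap.lsmul_apply]
  rw [integral_const_mul]

/-- Componentwise convolution of a vector field with a scalar kernel. -/
def mollify (ρ : Space → ℝ) (W : Space → CVec) (P : Space) : CVec :=
  WithLp.toLp 2 fun α => (ρ ⋆[lsmul ℝ ℝ] fun P' => W P' α) P

lemma tendsto_pairing_mollify {U W : Space → CVec} (hU : MemLp U 2) (hW : MemLp W 2)
    {φ : ℕ → ContDiffBump (0 : Space)} (hφ : Tendsto (fun n => (φ n).rOut) atTop (𝓝 0)) :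
    Tendsto (fun n => ∫ P, ∑ α, U P α * mollify ((φ n).normed volume) W P α) atTop
      (𝓝 (∫ P, ∑ α, U P α * W P α)) := by
  have hI : ∀ α ∈ Finset.univ, Integrable fun P => U P α * W P α :=
    fun α _ => (memLp_apply hU α).integrable_mul (memLp_apply hW α)
  rw [integral_finsetSum _ hI]
  refine (tendsto_finsetSum _ fun α _ => tendsto_integral_mul_mollify (memLp_apply hU α)
    (memLp_apply hW α) hφ).congr fun n => ?_
  rw [integral_finsetSum]
  · rfl
  · exact fun α _ => integrable_mul_convolution (memLp_apply hU α) (memLp_apply hW α)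
      (φ n).integrable_normed

/-! ### Calculus of the curl -/

lemma pderiv_eq {φ : Space → CVec} {P : Space} (h : DifferentiableAt ℝ φ P) (j k : Fin 3) :
    pderiv φ j k P = fderiv ℝ (fun P => φ P k) P (EuclideanSpace.single j 1) := by
  have := ((EuclideanSpace.proj (𝕜 := ℂ) k).restrictScalars ℝ).hasFDerivAt.comp P h.hasFDerivAt
  have e : fderiv ℝ (fun P => φ P k) P = _ := this.fderiv
  rw [e]
  rfl

lemma contDiff_apply {φ : Space → CVec} (h : ContDiff ℝ (⊤ : ℕ∞) φ) (k : Fin 3) :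
    ContDiff ℝ (⊤ : ℕ∞) fun P => φ P k :=
  ((EuclideanSpace.proj (𝕜 := ℂ) k).restrictScalars ℝ).contDiff.comp h

lemma contDiff_of_apply {φ : Space → CVec} (h : ∀ k, ContDiff ℝ (⊤ : ℕ∞) fun P => φ P k) :
    ContDiff ℝ (⊤ : ℕ∞) φ :=
  contDiff_piLp' 2 h

lemma hasCompactSupport_of_apply {φ : Space → CVec}
    (h : ∀ k, HasCompactSupport fun P => φ P k) : HasCompactSupport φ := by
  refine HasCompactSupport.intro (K := ⋃ k, tsupport fun P => φ P k)
    (isCompact_iUnion fun k => h k) fun P hP => ?_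
  ext k
  simp only [Set.mem_iUnion, not_exists] at hP
  exact image_eq_zero_of_notMem_tsupport (f := fun P => φ P k) (hP k)

lemma hasCompactSupport_apply {φ : Space → CVec} (h : HasCompactSupport φ) (k : Fin 3) :
    HasCompactSupport fun P => φ P k :=
  h.comp_left (g := fun v : CVec => v k) rfl

lemma continuous_pderiv {φ : Space → CVec} (h : ContDiff ℝ (⊤ : ℕ∞) φ) (j k : Fin 3) :
    Continuous (pderiv φ j k) := by
  have h1 : Continuous (fderiv ℝ φ) := h.continuous_fderiv (by simp)
  unfold pderiv
  fun_prop

lemma hasCompactSupport_pderiv {φ : Space → CVec} (h : HasCompactSupport φ) (j k : Fin 3) :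
    HasCompactSupport (pderiv φ j k) :=
  (h.fderiv ℝ).comp_left (g := fun A : Space →L[ℝ] CVec => (A (EuclideanSpace.single j 1)) k) rfl

lemma memLp_curl {φ : Space → CVec} (h : ContDiff ℝ (⊤ : ℕ∞) φ) (hc : HasCompactSupport φ) :
    MemLp (curl φ) 2 := by
  have hp : ∀ j k, MemLp (pderiv φ j k) 2 := fun j k =>
    (continuous_pderiv h j k).memLp_of_hasCompactSupport (hasCompactSupport_pderiv hc j k)
  refine memLp_of_apply fun α => ?_
  fin_cases α
  · exact (hp 1 2).sub (hp 2 1)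
  · exact (hp 2 0).sub (hp 0 2)
  · exact (hp 0 1).sub (hp 1 0)

lemma memLp_test {φ : Space → CVec} (h : ContDiff ℝ (⊤ : ℕ∞) φ) (hc : HasCompactSupport φ) :
    MemLp φ 2 :=
  h.continuous.memLp_of_hasCompactSupport hc

lemma fderiv_convolution_apply {ρ : Space → ℝ} {w : Space → ℂ} (hρ : ContDiff ℝ (⊤ : ℕ∞) ρ)
    (hc : HasCompactSupport ρ) (hw : LocallyIntegrable w) (P v : Space) :
    fderiv ℝ (ρ ⋆[lsmul ℝ ℝ] w) P v = ∫ y, fderiv ℝ ρ (P - y) v • w y := by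
  have h1 : ContDiff ℝ 1 ρ := hρ.of_le (by simp)
  rw [(hc.hasFDerivAt_convolution_left (lsmul ℝ ℝ) h1 hw P).fderiv]
  have hex := (hc.fderiv ℝ).convolutionExists_left
    ((lsmul ℝ ℝ : ℝ →L[ℝ] ℂ →L[ℝ] ℂ).precompL Space) (h1.continuous_fderiv one_ne_zero) hw P
  rw [convolution_def, ContinuousLinearMap.integral_apply hex,
    ← integral_sub_left_eq_self (fun y => fderiv ℝ ρ (P - y) v • w y) volume P]
  simp [ContinuousLinearMap.precompL_apply]

lemma convolution_apply_flip {ρ : Space → ℝ} {w : Space → ℂ} (P : Space) :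
    (ρ ⋆[lsmul ℝ ℝ] w) P = ∫ y, ρ (P - y) • w y := by
  rw [convolution_def, ← integral_sub_left_eq_self (fun y => ρ (P - y) • w y) volume P]
  simp

lemma contDiff_mollify {ρ : Space → ℝ} {W : Space → CVec} (hρ : ContDiff ℝ (⊤ : ℕ∞) ρ)
    (hc : HasCompactSupport ρ) (hW : MemLp W 2) : ContDiff ℝ (⊤ : ℕ∞) (mollify ρ W) :=
  contDiff_of_apply fun k => by
    have hl : LocallyIntegrable (fun P => W P k) :=
      (memLp_apply hW k).locallyIntegrable (by norm_num)
    have := hc.contDiff_convolution_left (lsmul ℝ ℝ) hρ hl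
    exact this

lemma hasCompactSupport_mollify {ρ : Space → ℝ} {W : Space → CVec}
    (hc : HasCompactSupport ρ) (hW : HasCompactSupport W) : HasCompactSupport (mollify ρ W) :=
  hasCompactSupport_of_apply fun k => by
    have := hc.convolution (lsmul ℝ ℝ) (μ := volume) (hasCompactSupport_apply hW k)
    exact this

lemma contDiff_single {f : Space → ℂ} (hf : ContDiff ℝ (⊤ : ℕ∞) f) (α : Fin 3) :
    ContDiff ℝ (⊤ : ℕ∞) fun y => (EuclideanSpace.single α (f y) : CVec) := by
  refine contDiff_of_apply fun k => ?_
  simp only [PiLp.single_apply]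
  by_cases h : k = α
  · simpa only [h, if_true] using hf
  · simpa only [h, if_false] using contDiff_const

lemma pderiv_single {f : Space → ℂ} (hf : ContDiff ℝ (⊤ : ℕ∞) f) (α j k : Fin 3) (y : Space) :
    pderiv (fun y => (EuclideanSpace.single α (f y) : CVec)) j k y =
      if k = α then fderiv ℝ f y (EuclideanSpace.single j 1) else 0 := by
  rw [pderiv_eq ((contDiff_single hf α).differentiable (by simp) y)]
  simp only [PiLp.single_apply]
  by_cases h : k = α <;> simp [h]

lemma fderiv_ofReal_comp_sub {ρ : Space → ℝ} (hρ : ContDiff ℝ (⊤ : ℕ∞) ρ) (P y v : Space) :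
    fderiv ℝ (fun y => (ρ (P - y) : ℂ)) y v = -(fderiv ℝ ρ (P - y) v : ℂ) := by
  have h0 := ((hρ.differentiable (by simp)) (P - y)).hasFDerivAt.comp y
    ((hasFDerivAt_const P y).sub (hasFDerivAt_id y))
  have h1 : HasFDerivAt (fun y => (ρ (P - y) : ℂ)) _ y := Complex.ofRealCLM.hasFDerivAt.comp y h0
  rw [h1.fderiv]
  simp

/-- The weak curl is tested against `y ↦ ρ(P - y) e_α`, whose own curl produces the derivatives of
the mollifier. -/
lemma curl_mollify {ρ : Space → ℝ} {F K : Space → CVec} (hρ : ContDiff ℝ (⊤ : ℕ∞) ρ)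
    (hc : HasCompactSupport ρ) (hF : MemLp F 2) (hFK : HasWeakCurl F K) (P : Space) :
    curl (mollify ρ F) P = mollify ρ K P := by
  have hd : DifferentiableAt ℝ (mollify ρ F) P :=
    (contDiff_mollify hρ hc hF).differentiable (by simp) P
  have hp : ∀ j k, pderiv (mollify ρ F) j k P =
      ∫ y, (fderiv ℝ ρ (P - y) (EuclideanSpace.single j 1) : ℂ) * F y k := fun j k => by
    rw [pderiv_eq hd]
    exact fderiv_convolution_apply hρ hc ((memLp_apply hF k).locallyIntegrable (by norm_num)) P _
  have hint : ∀ j k, Integrable fun y =>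
      (fderiv ℝ ρ (P - y) (EuclideanSpace.single j 1) : ℂ) * F y k := fun j k => by
    have hcont : Continuous fun y => fderiv ℝ ρ (P - y) (EuclideanSpace.single j 1) := by
      have := hρ.continuous_fderiv (by simp)
      fun_prop
    have hcs : HasCompactSupport fun y => fderiv ℝ ρ (P - y) (EuclideanSpace.single j 1) :=
      ((hc.fderiv ℝ).comp_left (g := fun A : Space →L[ℝ] ℝ => A (EuclideanSpace.single j 1))
        rfl).comp_homeomorph (Homeomorph.subLeft P)
    have hl : LocallyIntegrable (fun P => F P k) :=
      (memLp_apply hF k).locallyIntegrable (by norm_num)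
    exact hl.integrable_smul_left_of_hasCompactSupport hcont hcs
  have hsm : ContDiff ℝ (⊤ : ℕ∞) fun y => (ρ (P - y) : ℂ) :=
    Complex.ofRealCLM.contDiff.comp (hρ.comp (contDiff_const.sub contDiff_id))
  have htest : ∀ α : Fin 3,
      ∫ y, ∑ β, F y β * curl (fun y => EuclideanSpace.single α (ρ (P - y) : ℂ)) y β =
        mollify ρ K P α := fun α => by
    rw [hFK _ (contDiff_single hsm α)]
    · simp only [mollify, convolution_apply_flip]
      refine integral_congr_ae (ae_of_all _ fun y => ?_)
      simp [mul_comm]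
    · exact (hc.comp_homeomorph (Homeomorph.subLeft P)).comp_left
        (g := fun r : ℝ => (EuclideanSpace.single α (r : ℂ) : CVec)) (by simp)
  ext α
  rw [← htest α]
  fin_cases α <;>
  simp only [curl, Fin.sum_univ_three, pderiv_single hsm, fderiv_ofReal_comp_sub hρ] <;>
  simp only [Fin.isValue, Fin.reduceFinMk, Fin.zero_eta, Fin.mk_one, hp, Matrix.cons_val] <;>
  rw [← integral_sub (hint _ _) (hint _ _)] <;>
  refine integral_congr_ae (ae_of_all _ fun y => ?_) <;> simp <;> ring

/-! ### Integration by parts for square integrable fields -/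

/-- A mollification of a compactly supported `F` is a test function for the weak curl of `U`, and
its curl is the mollification of `K`. Both pairings then pass to the limit. -/
lemma integral_pairing_of_hasCompactSupport {U V F K : Space → CVec} (hU : MemLp U 2)
    (hV : MemLp V 2) (hF : MemLp F 2) (hK : MemLp K 2) (hUV : HasWeakCurl U V)
    (hFK : HasWeakCurl F K) (hc : HasCompactSupport F) :
    ∫ P, ∑ α, U P α * K P α = ∫ P, ∑ α, V P α * F P α := by
  let φ : ℕ → ContDiffBump (0 : Space) := fun n =>
    ⟨1 / (2 * ((n : ℝ) + 1)), 1 / ((n : ℝ) + 1), by positivity, by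
      apply one_div_lt_one_div_of_lt <;> linarith [n.cast_nonneg (α := ℝ)]⟩
  have hφ : Tendsto (fun n => (φ n).rOut) atTop (𝓝 0) := tendsto_one_div_add_atTop_nhds_zero_nat
  refine tendsto_nhds_unique (tendsto_pairing_mollify hU hK hφ)
    ((tendsto_pairing_mollify hV hF hφ).congr fun n => ?_)
  have hs : ContDiff ℝ (⊤ : ℕ∞) ((φ n).normed volume) := (φ n).contDiff_normed
  have hcs : HasCompactSupport ((φ n).normed (volume : Measure Space)) :=
    (φ n).hasCompactSupport_normed
  rw [← hUV _ (contDiff_mollify hs hcs hF) (hasCompactSupport_mollify hcs hc)]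
  simp only [curl_mollify hs hcs hF hFK]

/-! ### Cutoffs and the removal of the compact support assumption. -/

lemma memLp_bdd_mul {f w : Space → ℂ} {C : ℝ} (hf : AEStronglyMeasurable f)
    (hb : ∀ x, ‖f x‖ ≤ C) (hw : MemLp w 2) : MemLp (fun x => f x * w x) 2 :=
  hw.of_le_mul (hf.mul hw.1) (ae_of_all _ fun x => by
    rw [norm_mul]; exact mul_le_mul_of_nonneg_right (hb x) (norm_nonneg _))

/-- `∇χ × F`. -/
def gradCross (χ : Space → ℝ) (F : Space → CVec) (P : Space) : CVec :=
  !₂[(fderiv ℝ χ P (EuclideanSpace.single 1 1) : ℂ) * F P 2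
        - (fderiv ℝ χ P (EuclideanSpace.single 2 1) : ℂ) * F P 1,
     (fderiv ℝ χ P (EuclideanSpace.single 2 1) : ℂ) * F P 0
        - (fderiv ℝ χ P (EuclideanSpace.single 0 1) : ℂ) * F P 2,
     (fderiv ℝ χ P (EuclideanSpace.single 0 1) : ℂ) * F P 1
        - (fderiv ℝ χ P (EuclideanSpace.single 1 1) : ℂ) * F P 0]

lemma norm_gradCross_le {χ : Space → ℝ} {F : Space → CVec} {P : Space} {c : ℝ}
    (h : ∀ j, |fderiv ℝ χ P (EuclideanSpace.single j 1)| ≤ c) (α : Fin 3) :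
    ‖gradCross χ F P α‖ ≤ 2 * c * ‖F P‖ := by
  have key : ∀ i j k l : Fin 3, ‖(fderiv ℝ χ P (EuclideanSpace.single i 1) : ℂ) * F P j
      - (fderiv ℝ χ P (EuclideanSpace.single k 1) : ℂ) * F P l‖ ≤ 2 * c * ‖F P‖ := by
    intro i j k l
    have h1 : ∀ i j : Fin 3, ‖(fderiv ℝ χ P (EuclideanSpace.single i 1) : ℂ) * F P j‖
        ≤ c * ‖F P‖ := fun i j => by
      rw [norm_mul, Complex.norm_real, Real.norm_eq_abs]
      exact mul_le_mul (h i) (PiLp.norm_apply_le _ _) (norm_nonneg _)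
        ((abs_nonneg _).trans (h i))
    linarith [norm_sub_le ((fderiv ℝ χ P (EuclideanSpace.single i 1) : ℂ) * F P j)
      ((fderiv ℝ χ P (EuclideanSpace.single k 1) : ℂ) * F P l), h1 i j, h1 k l]
  fin_cases α
  · exact key 1 2 2 1
  · exact key 2 0 0 2
  · exact key 0 1 1 0

lemma pderiv_smul {χ : Space → ℝ} {φ : Space → CVec} (hχ : ContDiff ℝ (⊤ : ℕ∞) χ)
    (hφ : ContDiff ℝ (⊤ : ℕ∞) φ) (j k : Fin 3) (P : Space) :
    pderiv (fun P => χ P • φ P) j k P =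
      χ P * pderiv φ j k P + (fderiv ℝ χ P (EuclideanSpace.single j 1) : ℂ) * φ P k := by
  have h1 := (hχ.differentiable (by simp) P).hasFDerivAt.smul
    (hφ.differentiable (by simp) P).hasFDerivAt
  have h2 : HasFDerivAt (fun P => χ P • φ P) _ P := h1
  rw [pderiv, h2.fderiv]
  simp [pderiv]

lemma exists_norm_le_of_hasCompactSupport {E : Type*} [NormedAddCommGroup E] {f : Space → E}
    (hf : Continuous f) (hc : HasCompactSupport f) : ∃ C, ∀ x, ‖f x‖ ≤ C := by
  obtain ⟨C, hC⟩ := hf.bounded_above_of_compact_support hc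
  exact ⟨C, hC⟩

section Cutoff

variable {χ : Space → ℝ} {F K : Space → CVec}

lemma memLp_cutoff (hχ : ContDiff ℝ (⊤ : ℕ∞) χ) (hc : HasCompactSupport χ) (hF : MemLp F 2) :
    MemLp (fun P => χ P • F P) 2 := by
  obtain ⟨C, hC⟩ := exists_norm_le_of_hasCompactSupport hχ.continuous hc
  exact hF.of_le_mul (hχ.continuous.aestronglyMeasurable.smul hF.1) (ae_of_all _ fun x => by
    rw [norm_smul]; exact mul_le_mul_of_nonneg_right (hC x) (norm_nonneg _))

lemma memLp_gradCross (hχ : ContDiff ℝ (⊤ : ℕ∞) χ) (hc : HasCompactSupport χ)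
    (hF : MemLp F 2) : MemLp (gradCross χ F) 2 := by
  have h1 : Continuous (fderiv ℝ χ) := hχ.continuous_fderiv (by simp)
  obtain ⟨C, hC⟩ := exists_norm_le_of_hasCompactSupport h1 (hc.fderiv ℝ)
  have h2 : ∀ j k : Fin 3, MemLp
      (fun P => (fderiv ℝ χ P (EuclideanSpace.single j 1) : ℂ) * F P k) 2 := fun j k => by
    refine memLp_bdd_mul (C := C) (by fun_prop) (fun x => ?_) (memLp_apply hF k)
    rw [Complex.norm_real]
    exact ((fderiv ℝ χ x).le_opNorm _).trans (by simpa using hC x)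
  refine memLp_of_apply fun α => ?_
  fin_cases α
  · exact (h2 1 2).sub (h2 2 1)
  · exact (h2 2 0).sub (h2 0 2)
  · exact (h2 0 1).sub (h2 1 0)

/-- The product rule by duality: `χφ` is used as the test function, and the term `F·(∇χ × φ)` equals
`-(∇χ × F)·φ`. -/
lemma HasWeakCurl.cutoff (hχ : ContDiff ℝ (⊤ : ℕ∞) χ) (hc : HasCompactSupport χ)
    (hF : MemLp F 2) (hK : MemLp K 2) (hFK : HasWeakCurl F K) :
    HasWeakCurl (fun P => χ P • F P) (fun P => χ P • K P + gradCross χ F P) := by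
  intro φ hφ hφc
  have hsm : ContDiff ℝ (⊤ : ℕ∞) fun P => χ P • φ P := ContDiff.smul hχ hφ
  have hsc : HasCompactSupport fun P => χ P • φ P :=
    HasCompactSupport.smul_left (f := χ) hφc
  have h0 := hFK _ hsm hsc
  have i1 := integrable_pairing hF (memLp_curl hsm hsc)
  have i2 := integrable_pairing (memLp_gradCross hχ hc hF) (memLp_test hφ hφc)
  have i3 := integrable_pairing hK (memLp_test hsm hsc)
  have e1 : ∀ P, ∑ α, (χ P • F P) α * curl φ P α = ∑ α, F P α * curl (fun P => χ P • φ P) P α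
      + ∑ α, gradCross χ F P α * φ P α := fun P => by
    simp only [curl, pderiv_smul hχ hφ, gradCross, Fin.sum_univ_three, Fin.isValue,
      PiLp.smul_apply, Complex.real_smul, Matrix.cons_val_zero, Matrix.cons_val_one,
      Matrix.cons_val]
    ring
  have e2 : ∀ P, ∑ α, K P α * (χ P • φ P) α + ∑ α, gradCross χ F P α * φ P α =
      ∑ α, (χ P • K P + gradCross χ F P) α * φ P α := fun P => by
    simp only [Fin.sum_univ_three, PiLp.smul_apply, PiLp.add_apply, Complex.real_smul]
    ring
  simp only [e1, ← e2]
  rw [integral_add i1 i2, integral_add i3 i2, h0]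

end Cutoff

lemma tendsto_integral_pairing {U K : Space → CVec} {X : ℕ → Space → CVec} {b : Space → ℝ}
    (hU : MemLp U 2) (hb : MemLp b 2) (hX : ∀ n, MemLp (X n) 2) (hXb : ∀ n P α, ‖X n P α‖ ≤ b P)
    (hlim : ∀ P α, Tendsto (fun n => X n P α) atTop (𝓝 (K P α))) :
    Tendsto (fun n => ∫ P, ∑ α, U P α * X n P α) atTop (𝓝 (∫ P, ∑ α, U P α * K P α)) := by
  refine tendsto_integral_of_dominated_convergence (fun P => ∑ α, ‖U P α‖ * b P)
    (fun n => (integrable_pairing hU (hX n)).1)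
    (integrable_finsetSum _ fun α _ => (memLp_apply hU α).norm.integrable_mul hb)
    (fun n => ae_of_all _ fun P => ?_) (ae_of_all _ fun P => ?_)
  · refine (norm_sum_le _ _).trans (Finset.sum_le_sum fun α _ => ?_)
    rw [norm_mul]
    exact mul_le_mul_of_nonneg_left (hXb n P α) (norm_nonneg _)
  · exact tendsto_finsetSum _ fun α _ => (hlim P α).const_mul _

/-- Integration by parts for the weak curl of square integrable fields. -/
theorem integral_pairing_weakCurl {U V F K : Space → CVec} (hU : MemLp U 2)
    (hV : MemLp V 2) (hF : MemLp F 2) (hK : MemLp K 2) (hUV : HasWeakCurl U V)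
    (hFK : HasWeakCurl F K) :
    ∫ P, ∑ α, U P α * K P α = ∫ P, ∑ α, V P α * F P α := by
  let χ : ContDiffBump (0 : Space) := ⟨1, 2, one_pos, one_lt_two⟩
  -- Dilated cutoffs: each point is eventually in the region where `χn = 1`, and the gradients are
  -- `O(1/n)`, so the commutator term `∇χn × F` disappears in the limit.
  let χn : ℕ → Space → ℝ := fun n P => χ ((1 / ((n : ℝ) + 1)) • P)
  have hχs : ContDiff ℝ (⊤ : ℕ∞) χ := χ.contDiff
  have hs : ∀ n, ContDiff ℝ (⊤ : ℕ∞) (χn n) := fun n =>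
    hχs.comp (contDiff_const_smul (1 / ((n : ℝ) + 1)))
  have hne : ∀ n : ℕ, (1 / ((n : ℝ) + 1)) ≠ 0 := fun n => by positivity
  have hcs : ∀ n, HasCompactSupport (χn n) := fun n =>
    χ.hasCompactSupport.comp_homeomorph (Homeomorph.smulOfNeZero _ (hne n))
  have hle : ∀ n P, |χn n P| ≤ 1 := fun n P => by
    rw [abs_of_nonneg χ.nonneg]; exact χ.le_one
  obtain ⟨C, hC⟩ := exists_norm_le_of_hasCompactSupport
    (hχs.continuous_fderiv (by simp)) (χ.hasCompactSupport.fderiv ℝ)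
  have hder : ∀ n P j, |fderiv ℝ (χn n) P (EuclideanSpace.single j 1)| ≤ 1 / ((n : ℝ) + 1) * C := by
    intro n P j
    have h1 := ((hχs.differentiable (by simp)) ((1 / ((n : ℝ) + 1)) • P)).hasFDerivAt.comp P
      ((hasFDerivAt_id P).const_smul (1 / ((n : ℝ) + 1)))
    have h2 : HasFDerivAt (χn n) _ P := h1
    rw [h2.fderiv]
    have h3 := (fderiv ℝ χ ((1 / ((n : ℝ) + 1)) • P)).le_opNorm (EuclideanSpace.single j 1)
    have h4 : (0 : ℝ) ≤ 1 / ((n : ℝ) + 1) := by positivity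
    have h5 := mul_le_mul_of_nonneg_left (h3.trans (by simpa using hC _)) h4
    simpa [abs_mul, abs_of_nonneg h4, abs_of_nonneg (by positivity : (0 : ℝ) ≤ n + 1)] using h5
  have hC0 : 0 ≤ C := (norm_nonneg _).trans (hC 0)
  -- A bound uniform in `n`, for dominated convergence; the decaying bound `hder` gives the
  -- pointwise limit.
  have hder' : ∀ n P j, |fderiv ℝ (χn n) P (EuclideanSpace.single j 1)| ≤ C := fun n P j =>
    (hder n P j).trans (mul_le_of_le_one_left hC0 (by
      rw [div_le_one (by positivity)]; linarith [n.cast_nonneg (α := ℝ)]))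
  have hone : ∀ P, ∀ᶠ n in atTop, χn n P = 1 := fun P => by
    have : Tendsto (fun n : ℕ => (1 / ((n : ℝ) + 1)) • P) atTop (𝓝 0) := by
      simpa using (tendsto_one_div_add_atTop_nhds_zero_nat (𝕜 := ℝ)).smul_const P
    filter_upwards [this.eventually (Metric.closedBall_mem_nhds (0 : Space) one_pos)] with n hn
    exact χ.one_of_mem_closedBall hn
  have hnorm : ∀ n (W : Space → CVec) P α, ‖(χn n P • W P) α‖ ≤ ‖W P‖ := fun n W P α => by
    refine (PiLp.norm_apply_le _ _).trans ?_
    rw [norm_smul]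
    exact mul_le_of_le_one_left (norm_nonneg _) (hle n P)
  have hlim : ∀ (W : Space → CVec) P α,
      Tendsto (fun n => (χn n P • W P) α) atTop (𝓝 (W P α)) := fun W P α =>
    tendsto_const_nhds.congr' ((hone P).mono fun n hn => by simp [hn])
  have L1 := tendsto_integral_pairing (U := V) (K := F) (X := fun n P => χn n P • F P)
    (b := fun P => ‖F P‖) hV hF.norm (fun n => memLp_cutoff (hs n) (hcs n) hF)
    (fun n => hnorm n F) (hlim F)
  have L2 := tendsto_integral_pairing (U := U) (K := K)
    (X := fun n P => χn n P • K P + gradCross (χn n) F P)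
    (b := fun P => ‖K P‖ + 2 * C * ‖F P‖) hU (hK.norm.add (hF.norm.const_mul _))
    (fun n => (memLp_cutoff (hs n) (hcs n) hK).add (memLp_gradCross (hs n) (hcs n) hF))
    (fun n P α => (norm_add_le _ _).trans (add_le_add (hnorm n K P α)
      (norm_gradCross_le (hder' n P) α))) (fun P α => by
      have h1 : Tendsto (fun n => gradCross (χn n) F P α) atTop (𝓝 0) := by
        refine squeeze_zero_norm (fun n => norm_gradCross_le (hder n P) α) ?_
        have := ((tendsto_one_div_add_atTop_nhds_zero_nat (𝕜 := ℝ)).mul_const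
          C).const_mul 2 |>.mul_const ‖F P‖
        simpa using this
      simpa using (hlim K P α).add h1)
  refine tendsto_nhds_unique L2 (L1.congr fun n => ?_)
  exact (integral_pairing_of_hasCompactSupport hU hV (memLp_cutoff (hs n) (hcs n) hF)
    ((memLp_cutoff (hs n) (hcs n) hK).add (memLp_gradCross (hs n) (hcs n) hF)) hUV
    (hFK.cutoff (hs n) (hcs n) hF hK) (hcs n).smul_right).symm

/-! ### Uniqueness and reciprocity for dissipative profiles -/

/-- A bounded measurable conductivity profile with positive real part. -/
structure IsDissipative (σ : ℝ → ℂ) : Prop where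
  measurable : Measurable σ
  bounded : ∃ C, ∀ z, ‖σ z‖ ≤ C
  re_pos : ∀ z, 0 < (σ z).re

lemma LayeredMedium.measurable_layerOf (L : LayeredMedium) : Measurable L.layerOf := by
  have h : Measurable fun z => (Finset.univ.filter fun k => L.interface k < z).card := by
    simp only [Finset.card_filter]
    exact Finset.measurable_sum _ fun k _ =>
      Measurable.ite (measurableSet_lt measurable_const measurable_id) measurable_const
        measurable_const
  refine measurable_to_countable' fun x => ?_
  convert! h (measurableSet_singleton (x : ℕ)) using 1
  ext z
  simp [LayeredMedium.layerOf, Fin.ext_iff]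

lemma LayeredMedium.measurable_conductivity (L : LayeredMedium) : Measurable L.conductivity :=
  (measurable_from_top (f := L.layerConductivity)).comp L.measurable_layerOf

lemma LayeredMedium.exists_norm_conductivity_le (L : LayeredMedium) :
    ∃ C, ∀ z, ‖L.conductivity z‖ ≤ C := by
  obtain ⟨C, hC⟩ := (Set.finite_range fun k => ‖L.layerConductivity k‖).bddAbove
  exact ⟨C, fun z => hC ⟨L.layerOf z, rfl⟩⟩

lemma LayeredMedium.IsLossy.isDissipative {L : LayeredMedium} (h : L.IsLossy) :
    IsDissipative L.conductivity :=
  ⟨L.measurable_conductivity, L.exists_norm_conductivity_le, fun z => h (L.layerOf z)⟩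

/-- Absorption makes every layer strictly dissipative, so the theory below applies to each
approximating medium. -/
lemma LayeredMedium.isDissipative_add (L : LayeredMedium) {ε : ℝ} (hε : 0 < ε) :
    IsDissipative fun z => L.conductivity z + (ε : ℂ) := by
  refine ⟨L.measurable_conductivity.add_const _, ?_, fun z => ?_⟩
  · obtain ⟨C, hC⟩ := L.exists_norm_conductivity_le
    exact ⟨C + ‖(ε : ℂ)‖, fun z => (norm_add_le _ _).trans (by linarith [hC z])⟩
  · have := L.re_nonneg (L.layerOf z)
    simp only [LayeredMedium.conductivity, Complex.add_re, Complex.ofReal_re]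
    linarith

lemma measurable_coord (i : Fin 3) : Measurable fun P : Space => P i := by fun_prop

lemma IsDissipative.memLp_smul {σ : ℝ → ℂ} (hσ : IsDissipative σ) {E : Space → CVec}
    (hE : MemLp E 2) : MemLp (fun P => σ (P 2) • E P) 2 := by
  obtain ⟨C, hC⟩ := hσ.bounded
  exact hE.of_le_mul (c := C)
    ((hσ.measurable.comp (measurable_coord 2)).aestronglyMeasurable.smul hE.1)
    (ae_of_all _ fun P => by
      rw [norm_smul]; exact mul_le_mul_of_nonneg_right (hC _) (norm_nonneg _))

/-! ### Linearity of the weak curl and of the field equations. -/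

section Linear

lemma memLp_const_smul {U : Space → CVec} (hU : MemLp U 2) (a : ℂ) :
    MemLp (fun P => a • U P) 2 :=
  hU.const_smul a

lemma HasWeakCurl.add {U V U' V' : Space → CVec} (h : HasWeakCurl U V) (h' : HasWeakCurl U' V')
    (hU : MemLp U 2) (hV : MemLp V 2) (hU' : MemLp U' 2) (hV' : MemLp V' 2) :
    HasWeakCurl (fun P => U P + U' P) (fun P => V P + V' P) := by
  intro φ hφ hc
  have m1 := memLp_curl hφ hc
  have m2 := memLp_test hφ hc
  simp only [PiLp.add_apply, add_mul, Finset.sum_add_distrib]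
  rw [integral_add (integrable_pairing hU m1) (integrable_pairing hU' m1),
    integral_add (integrable_pairing hV m2) (integrable_pairing hV' m2), h φ hφ hc, h' φ hφ hc]

lemma HasWeakCurl.const_smul {U V : Space → CVec} (h : HasWeakCurl U V) (a : ℂ) :
    HasWeakCurl (fun P => a • U P) (fun P => a • V P) := by
  intro φ hφ hc
  simp only [PiLp.smul_apply, smul_eq_mul, mul_assoc, ← Finset.mul_sum]
  rw [integral_const_mul, integral_const_mul, h φ hφ hc]

lemma HasWeakCurl.congr {U V V' : Space → CVec} (h : HasWeakCurl U V) (hV : V =ᵐ[volume] V') :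
    HasWeakCurl U V' := by
  intro φ hφ hc
  rw [h φ hφ hc]
  refine integral_congr_ae ?_
  filter_upwards [hV] with P hP
  rw [hP]

variable {σ : ℝ → ℂ} {ω μ₀ : ℝ}

lemma IsFiniteEnergyField.add (hσ : IsDissipative σ) {J E H J' E' H' : Space → CVec}
    (h : IsFiniteEnergyField σ ω μ₀ J E H) (h' : IsFiniteEnergyField σ ω μ₀ J' E' H')
    (hJ : MemLp J 2) (hJ' : MemLp J' 2) :
    IsFiniteEnergyField σ ω μ₀ (fun P => J P + J' P) (fun P => E P + E' P)
      (fun P => H P + H' P) := by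
  obtain ⟨hE, hH, c1, c2⟩ := h
  obtain ⟨hE', hH', c1', c2'⟩ := h'
  refine ⟨hE.add hE', hH.add hH', ?_, ?_⟩
  · refine (c1.add c1' hH ((hσ.memLp_smul hE).add hJ) hH' ((hσ.memLp_smul hE').add hJ')).congr
      (ae_of_all _ fun P => ?_)
    simp only [smul_add]
    abel
  · refine (c2.add c2' hE (memLp_const_smul hH _) hE' (memLp_const_smul hH' _)).congr
      (ae_of_all _ fun P => ?_)
    simp only [smul_add]

lemma IsFiniteEnergyField.const_smul {J E H : Space → CVec}
    (h : IsFiniteEnergyField σ ω μ₀ J E H) (a : ℂ) :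
    IsFiniteEnergyField σ ω μ₀ (fun P => a • J P) (fun P => a • E P) (fun P => a • H P) := by
  obtain ⟨hE, hH, c1, c2⟩ := h
  refine ⟨hE.const_smul a, hH.const_smul a, ?_, ?_⟩
  · refine (c1.const_smul a).congr (ae_of_all _ fun P => ?_)
    simp only [smul_add, smul_comm a]
  · refine (c2.const_smul a).congr (ae_of_all _ fun P => ?_)
    simp only [smul_comm a]

lemma IsFiniteEnergyField.congr {J J' E H : Space → CVec}
    (h : IsFiniteEnergyField σ ω μ₀ J E H) (hJ : J =ᵐ[volume] J') :
    IsFiniteEnergyField σ ω μ₀ J' E H := by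
  obtain ⟨hE, hH, c1, c2⟩ := h
  refine ⟨hE, hH, c1.congr ?_, c2⟩
  filter_upwards [hJ] with P hP
  rw [hP]

end Linear

/-- The complex conjugate field. -/
def conjField (U : Space → CVec) (P : Space) : CVec :=
  WithLp.toLp 2 fun α => (starRingEnd ℂ) (U P α)

lemma memLp_conjField {U : Space → CVec} (hU : MemLp U 2) : MemLp (conjField U) 2 :=
  memLp_of_apply fun α => (memLp_apply hU α).star

lemma contDiff_conjField {φ : Space → CVec} (h : ContDiff ℝ (⊤ : ℕ∞) φ) :
    ContDiff ℝ (⊤ : ℕ∞) (conjField φ) :=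
  contDiff_of_apply fun k => Complex.conjCLE.contDiff.comp (contDiff_apply h k)

lemma hasCompactSupport_conjField {φ : Space → CVec} (h : HasCompactSupport φ) :
    HasCompactSupport (conjField φ) :=
  hasCompactSupport_of_apply fun k => (hasCompactSupport_apply h k).comp_left
    (g := starRingEnd ℂ) (map_zero _)

lemma curl_conjField {φ : Space → CVec} (h : ContDiff ℝ (⊤ : ℕ∞) φ) :
    curl (conjField φ) = conjField (curl φ) := by
  have hp : ∀ j k P, pderiv (conjField φ) j k P = (starRingEnd ℂ) (pderiv φ j k P) := by
    intro j k P
    rw [pderiv_eq (h.differentiable (by simp) P),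
      pderiv_eq ((contDiff_conjField h).differentiable (by simp) P)]
    have h1 : HasFDerivAt (fun P => conjField φ P k) _ P :=
      Complex.conjCLE.toContinuousLinearMap.hasFDerivAt.comp P
        ((contDiff_apply h k).differentiable (by simp) P).hasFDerivAt
    rw [h1.fderiv]
    rfl
  ext P α
  fin_cases α <;> simp [curl, hp, conjField]

lemma HasWeakCurl.conj {U V : Space → CVec} (h : HasWeakCurl U V) :
    HasWeakCurl (conjField U) (conjField V) := by
  intro φ hφ hc
  have h0 := h (conjField φ) (contDiff_conjField hφ) (hasCompactSupport_conjField hc)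
  rw [curl_conjField hφ] at h0
  have h1 := congrArg (starRingEnd ℂ) h0
  rw [← integral_conj, ← integral_conj] at h1
  simpa [conjField] using h1

/-! ### The energy identity, uniqueness and reciprocity. -/

section Uniqueness

variable {σ : ℝ → ℂ} {ω μ₀ : ℝ}

/-- Pairing `H` with the conjugate of `E` gives `∫ σ|E|² = -iωμ₀ ∫ |H|²`. The right side is purely
imaginary, so `∫ Re σ |E|² = 0`. -/
lemma IsFiniteEnergyField.ae_eq_zero (hσ : IsDissipative σ) {E H : Space → CVec}
    (h : IsFiniteEnergyField σ ω μ₀ 0 E H) : E =ᵐ[volume] 0 := by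
  obtain ⟨hE, hH, c1, c2⟩ := h
  simp only [Pi.zero_apply, add_zero] at c1
  have hσE := hσ.memLp_smul hE
  have key := integral_pairing_weakCurl hH hσE (memLp_conjField hE)
    (memLp_conjField (memLp_const_smul hH (Complex.I * ω * μ₀))) c1 c2.conj
  have i1 : Integrable fun P => ∑ α, (σ (P 2) • E P) α * conjField E P α :=
    integrable_pairing hσE (memLp_conjField hE)
  have e1 : ∀ P, (∑ α, (σ (P 2) • E P) α * conjField E P α).re = (σ (P 2)).re * ‖E P‖ ^ 2 := by
    intro P
    simp only [PiLp.smul_apply, smul_eq_mul, conjField, mul_assoc, Complex.mul_conj,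
      ← Finset.mul_sum, EuclideanSpace.norm_sq_eq, Complex.normSq_eq_norm_sq]
    rw [← Complex.ofReal_sum, Complex.re_mul_ofReal]
  have e2 : ∀ P, ∑ α, H P α * conjField (fun P => (Complex.I * ω * μ₀) • H P) P α =
      -(Complex.I * ω * μ₀) * ((∑ α, ‖H P α‖ ^ 2 : ℝ) : ℂ) := by
    intro P
    rw [Complex.ofReal_sum, Finset.mul_sum]
    refine Finset.sum_congr rfl fun α _ => ?_
    rw [← Complex.normSq_eq_norm_sq, ← Complex.mul_conj]
    simp only [conjField, PiLp.smul_apply, smul_eq_mul, map_mul, Complex.conj_I,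
      Complex.conj_ofReal]
    ring
  have key2 : ∫ P, (σ (P 2)).re * ‖E P‖ ^ 2 = 0 := by
    simp only [← e1]
    rw [show ∫ P, (∑ α, (σ (P 2) • E P) α * conjField E P α).re = _ from integral_re i1, ← key]
    simp only [e2]
    rw [integral_const_mul, integral_complex_ofReal]
    simp
  have hnn : 0 ≤ᵐ[volume] fun P => (σ (P 2)).re * ‖E P‖ ^ 2 :=
    ae_of_all _ fun P => mul_nonneg (hσ.re_pos _).le (sq_nonneg _)
  have i2 : Integrable fun P => (σ (P 2)).re * ‖E P‖ ^ 2 := by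
    have := i1.re
    exact this.congr (ae_of_all _ e1)
  filter_upwards [(integral_eq_zero_iff_of_nonneg_ae hnn i2).1 key2] with P hP
  have : ‖E P‖ ^ 2 = 0 := (mul_eq_zero.1 hP).resolve_left (hσ.re_pos _).ne'
  simpa using this

lemma IsFiniteEnergyField.ae_eq (hσ : IsDissipative σ) {J E H E' H' : Space → CVec}
    (hJ : MemLp J 2) (h : IsFiniteEnergyField σ ω μ₀ J E H)
    (h' : IsFiniteEnergyField σ ω μ₀ J E' H') : E =ᵐ[volume] E' := by
  have h0 := (h.add hσ (h'.const_smul (-1)) hJ (memLp_const_smul hJ _)).congr (J' := 0)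
    (ae_of_all _ fun P => by simp)
  filter_upwards [h0.ae_eq_zero hσ] with P hP
  simpa [← sub_eq_add_neg, sub_eq_zero] using hP

/-- Reciprocity. -/
lemma IsFiniteEnergyField.reciprocity (hσ : IsDissipative σ) {J E H J' E' H' : Space → CVec}
    (hJ : MemLp J 2) (hJ' : MemLp J' 2) (h : IsFiniteEnergyField σ ω μ₀ J E H)
    (h' : IsFiniteEnergyField σ ω μ₀ J' E' H') :
    ∫ P, ∑ α, J P α * E' P α = ∫ P, ∑ α, J' P α * E P α := by
  obtain ⟨hE, hH, c1, c2⟩ := h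
  obtain ⟨hE', hH', c1', c2'⟩ := h'
  have m1 := hσ.memLp_smul hE
  have m2 := hσ.memLp_smul hE'
  -- Each magnetic field is paired with the other electric field. The terms `iωμ₀ H·H'` and `σ E·E'`
  -- are symmetric in the two solutions and cancel, leaving the source terms.
  have k1 := integral_pairing_weakCurl hH (m1.add hJ) hE' (memLp_const_smul hH' _) c1 c2'
  have k2 := integral_pairing_weakCurl hH' (m2.add hJ') hE (memLp_const_smul hH _) c1' c2
  have e : ∫ P, ∑ α, H P α * ((Complex.I * ω * μ₀) • H' P) α =
      ∫ P, ∑ α, H' P α * ((Complex.I * ω * μ₀) • H P) α := by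
    refine integral_congr_ae (ae_of_all _ fun P => Finset.sum_congr rfl fun α _ => ?_)
    simp only [PiLp.smul_apply, smul_eq_mul]; ring
  have e' : ∫ P, ∑ α, (σ (P 2) • E P) α * E' P α = ∫ P, ∑ α, (σ (P 2) • E' P) α * E P α := by
    refine integral_congr_ae (ae_of_all _ fun P => Finset.sum_congr rfl fun α _ => ?_)
    simp only [PiLp.smul_apply, smul_eq_mul]; ring
  have s1 : ∫ P, ∑ α, (σ (P 2) • E P + J P) α * E' P α =
      (∫ P, ∑ α, (σ (P 2) • E P) α * E' P α) + ∫ P, ∑ α, J P α * E' P α := by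
    rw [← integral_add (integrable_pairing m1 hE') (integrable_pairing hJ hE')]
    simp only [PiLp.add_apply, add_mul, Finset.sum_add_distrib]
  have s2 : ∫ P, ∑ α, (σ (P 2) • E' P + J' P) α * E P α =
      (∫ P, ∑ α, (σ (P 2) • E' P) α * E P α) + ∫ P, ∑ α, J' P α * E P α := by
    rw [← integral_add (integrable_pairing m2 hE) (integrable_pairing hJ' hE)]
    simp only [PiLp.add_apply, add_mul, Finset.sum_add_distrib]
  have k1' := k1.trans s1
  have k2' := k2.trans s2
  linear_combination e + k2' - k1' - e'

end Uniqueness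

/-! ### Reflections in vertical planes -/

/-- The reflection `(x, y, z) ↦ (c x + s y + a, s x - c y + b, z)` in a vertical plane. -/
structure VerticalMirror where
  c : ℝ
  s : ℝ
  a : ℝ
  b : ℝ
  unit : c ^ 2 + s ^ 2 = 1
  -- The linear part sends `(a, b)` to `-(a, b)`: the translation is normal to the plane, which
  -- excludes glide reflections and makes the map an involution.
  fix_x : c * a + s * b + a = 0
  fix_y : s * a - c * b + b = 0

namespace VerticalMirror

variable (M : VerticalMirror)

/-- The linear part of the reflection. -/
def linear : Space →L[ℝ] Space :=
  LinearMap.toContinuousLinearMap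
    { toFun := fun P => !₂[M.c * P 0 + M.s * P 1, M.s * P 0 - M.c * P 1, P 2]
      map_add' := fun P Q => by ext i; fin_cases i <;> simp <;> ring
      map_smul' := fun r P => by ext i; fin_cases i <;> simp <;> ring }

/-- The reflection as a map of space. -/
def map (P : Space) : Space := M.linear P + !₂[M.a, M.b, 0]

/-- The action of the linear part on complex vectors. -/
def vec : CVec →L[ℂ] CVec :=
  LinearMap.toContinuousLinearMap
    { toFun := fun v => !₂[(M.c : ℂ) * v 0 + M.s * v 1, (M.s : ℂ) * v 0 - M.c * v 1, v 2]
      map_add' := fun P Q => by ext i; fin_cases i <;> simp <;> ring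
      map_smul' := fun r P => by ext i; fin_cases i <;> simp <;> ring }

/-- The matrix of the linear part. -/
def mat : Tensor := !![(M.c : ℂ), M.s, 0; M.s, -M.c, 0; 0, 0, 1]

/-- The reflected vector field. -/
def field (U : Space → CVec) (P : Space) : CVec := M.vec (U (M.map P))

lemma linear_apply (P : Space) :
    M.linear P = !₂[M.c * P 0 + M.s * P 1, M.s * P 0 - M.c * P 1, P 2] := rfl

lemma vec_apply (v : CVec) :
    M.vec v = !₂[(M.c : ℂ) * v 0 + M.s * v 1, (M.s : ℂ) * v 0 - M.c * v 1, v 2] := rfl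

lemma map_apply (P : Space) :
    M.map P = !₂[M.c * P 0 + M.s * P 1 + M.a, M.s * P 0 - M.c * P 1 + M.b, P 2] := by
  ext i
  fin_cases i <;> simp [map, linear_apply]

lemma map_map (P : Space) : M.map (M.map P) = P := by
  have h1 := M.unit
  have h2 := M.fix_x
  have h3 := M.fix_y
  ext i
  fin_cases i
  · simp only [map_apply, Fin.zero_eta, Fin.isValue, Matrix.cons_val_zero, Matrix.cons_val_one]
    linear_combination P 0 * h1 + h2
  · simp only [map_apply, Fin.mk_one, Fin.isValue, Matrix.cons_val_zero, Matrix.cons_val_one]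
    linear_combination P 1 * h1 + h3
  · simp [map_apply]

lemma vec_vec (v : CVec) : M.vec (M.vec v) = v := by
  have h1 : (M.c : ℂ) ^ 2 + (M.s : ℂ) ^ 2 = 1 := by exact_mod_cast M.unit
  ext i
  fin_cases i
  · simp only [vec_apply, Fin.zero_eta, Fin.isValue, Matrix.cons_val_zero, Matrix.cons_val_one]
    linear_combination v 0 * h1
  · simp only [vec_apply, Fin.mk_one, Fin.isValue, Matrix.cons_val_zero, Matrix.cons_val_one]
    linear_combination v 1 * h1
  · simp [vec_apply]

lemma map_two (P : Space) : M.map P 2 = P 2 := by simp [map_apply]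

lemma isometry_map : Isometry M.map := by
  refine Isometry.of_dist_eq fun P Q => ?_
  rw [EuclideanSpace.dist_eq, EuclideanSpace.dist_eq]
  congr 1
  simp only [Fin.sum_univ_three, Real.dist_eq, sq_abs, map_apply, Fin.isValue,
    Matrix.cons_val_zero, Matrix.cons_val_one, Matrix.cons_val]
  linear_combination ((P 0 - Q 0) ^ 2 + (P 1 - Q 1) ^ 2) * M.unit

/-- The reflection as an isometric equivalence. -/
def isometryEquiv : Space ≃ᵢ Space where
  toFun := M.map
  invFun := M.map
  left_inv := M.map_map
  right_inv := M.map_map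
  isometry_toFun := M.isometry_map

/-- Isometries preserve Hausdorff measure, which in dimension three is the volume. -/
lemma measurePreserving : MeasurePreserving M.map := by
  have := M.isometryEquiv.measurePreserving_euclideanHausdorffMeasure 3
  rwa [EuclideanSpace.euclideanHausdorffMeasure_eq_volume] at this

lemma measurableEmbedding : MeasurableEmbedding M.map :=
  M.isometryEquiv.toHomeomorph.measurableEmbedding

lemma integral_comp {F : Type*} [NormedAddCommGroup F] [NormedSpace ℝ F] (f : Space → F) :
    ∫ P, f (M.map P) = ∫ P, f P :=
  M.measurePreserving.integral_comp M.measurableEmbedding f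

lemma memLp_field {U : Space → CVec} (hU : MemLp U 2) : MemLp (M.field U) 2 :=
  M.vec.comp_memLp' (hU.comp_measurePreserving M.measurePreserving)

lemma hasFDerivAt_map (P : Space) : HasFDerivAt M.map M.linear P :=
  M.linear.hasFDerivAt.add_const _

lemma contDiff_field {φ : Space → CVec} (h : ContDiff ℝ (⊤ : ℕ∞) φ) :
    ContDiff ℝ (⊤ : ℕ∞) (M.field φ) := by
  have h1 : ContDiff ℝ (⊤ : ℕ∞) M.map := M.linear.contDiff.add contDiff_const
  exact (M.vec.restrictScalars ℝ).contDiff.comp (h.comp h1)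

lemma hasCompactSupport_field {φ : Space → CVec} (h : HasCompactSupport φ) :
    HasCompactSupport (M.field φ) :=
  (h.comp_homeomorph M.isometryEquiv.toHomeomorph).comp_left (g := M.vec) (map_zero _)

lemma pderiv_field {φ : Space → CVec} (h : ContDiff ℝ (⊤ : ℕ∞) φ) (j k : Fin 3) (P : Space) :
    pderiv (M.field φ) j k P =
      M.vec (fderiv ℝ φ (M.map P) (M.linear (EuclideanSpace.single j 1))) k := by
  have h1 : HasFDerivAt (M.field φ) _ P := (M.vec.restrictScalars ℝ).hasFDerivAt.comp P
    ((h.differentiable (by simp) (M.map P)).hasFDerivAt.comp P (M.hasFDerivAt_map P))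
  rw [pderiv, h1.fderiv]
  rfl

/-- The reflection reverses orientation and the curl is a pseudovector, hence the minus sign. -/
lemma curl_field {φ : Space → CVec} (h : ContDiff ℝ (⊤ : ℕ∞) φ) (P : Space) :
    curl (M.field φ) P = -M.vec (curl φ (M.map P)) := by
  have h0 : M.linear (EuclideanSpace.single 0 1) =
      M.c • EuclideanSpace.single 0 1 + M.s • EuclideanSpace.single 1 1 := by
    ext i; fin_cases i <;> simp [linear_apply]
  have h1 : M.linear (EuclideanSpace.single 1 1) =
      M.s • EuclideanSpace.single 0 1 - M.c • EuclideanSpace.single 1 1 := by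
    ext i; fin_cases i <;> simp [linear_apply]
  have h2 : M.linear (EuclideanSpace.single 2 1) = EuclideanSpace.single 2 1 := by
    ext i; fin_cases i <;> simp [linear_apply]
  have hu : (M.c : ℂ) ^ 2 + (M.s : ℂ) ^ 2 = 1 := by exact_mod_cast M.unit
  ext α
  fin_cases α <;>
  simp only [curl, pderiv_field M h, h0, h1, h2] <;>
  simp only [pderiv, map_add, map_sub, map_smul, vec_apply,
    PiLp.add_apply, PiLp.sub_apply, PiLp.smul_apply, PiLp.neg_apply, Complex.real_smul,
    Fin.zero_eta, Fin.mk_one, Fin.reduceFinMk, Fin.isValue, Matrix.cons_val_zero,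
    Matrix.cons_val_one, Matrix.cons_val]
  · ring
  · ring
  · linear_combination (fderiv ℝ φ (M.map P) (EuclideanSpace.single 1 1) 0 -
      fderiv ℝ φ (M.map P) (EuclideanSpace.single 0 1) 1) * hu

lemma pairing_vec (v w : CVec) : ∑ α, M.vec v α * w α = ∑ α, v α * M.vec w α := by
  simp only [vec_apply, Fin.sum_univ_three, Fin.isValue, Matrix.cons_val_zero,
    Matrix.cons_val_one, Matrix.cons_val]
  ring

lemma integral_pairing_field (U V : Space → CVec) :
    ∫ P, ∑ α, M.field U P α * V P α = ∫ P, ∑ α, U P α * M.field V P α := by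
  rw [← M.integral_comp]
  simp only [field, map_map, pairing_vec]

/-- The reflection of fields is its own transpose for the pairing, so it can be moved onto the test
function, where `curl_field` applies. -/
lemma hasWeakCurl_field {U V : Space → CVec} (h : HasWeakCurl U V) :
    HasWeakCurl (M.field U) (fun P => -M.field V P) := by
  intro φ hφ hc
  have h1 : M.field (curl φ) = fun P => -curl (M.field φ) P := by
    ext1 P
    rw [M.curl_field hφ, field, neg_neg]
  rw [integral_pairing_field, h1]
  simp only [PiLp.neg_apply, mul_neg, neg_mul, Finset.sum_neg_distrib, integral_neg]
  rw [integral_pairing_field, h _ (M.contDiff_field hφ) (M.hasCompactSupport_field hc)]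

/-- Heights are fixed, so `σ` is unchanged; the sign from the curl is absorbed by the axial field
`H`. -/
lemma isFiniteEnergyField {σ : ℝ → ℂ} {ω μ₀ : ℝ} {J E H : Space → CVec}
    (h : IsFiniteEnergyField σ ω μ₀ J E H) :
    IsFiniteEnergyField σ ω μ₀ (M.field J) (M.field E) (fun P => (-1 : ℂ) • M.field H P) := by
  obtain ⟨hE, hH, c1, c2⟩ := h
  refine ⟨M.memLp_field hE, memLp_const_smul (M.memLp_field hH) _, ?_, ?_⟩
  · refine ((M.hasWeakCurl_field c1).const_smul (-1)).congr (ae_of_all _ fun P => ?_)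
    simp [field, map_two, add_comm]
  · refine (M.hasWeakCurl_field c2).congr (ae_of_all _ fun P => ?_)
    simp [field]

end VerticalMirror

/-! ### Averaged responses between two regions -/

/-- The unit current in direction `β` supported in `B`. -/
def regionCurrent (B : Set Space) (β : Fin 3) : Space → CVec :=
  B.indicator fun _ => EuclideanSpace.single β 1

lemma memLp_regionCurrent {B : Set Space} (hB : MeasurableSet B) (hB' : volume B ≠ ⊤)
    (β : Fin 3) : MemLp (regionCurrent B β) 2 :=
  memLp_indicator_const 2 hB _ (Or.inr hB')

lemma regionCurrent_apply (B : Set Space) (β γ : Fin 3) (P : Space) :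
    regionCurrent B β P γ = if γ = β then B.indicator 1 P else 0 := by
  classical
  by_cases h : P ∈ B <;> simp [regionCurrent, h, PiLp.single_apply]

/-- `T α β` is the integral over `A` of the component `α` of the field that is excited by the
unit current in direction `β` supported in `B`. -/
def IsResponse (σ : ℝ → ℂ) (ω μ₀ : ℝ) (A B : Set Space) (T : Tensor) : Prop :=
  ∀ β, ∃ E H : Space → CVec, IsFiniteEnergyField σ ω μ₀ (regionCurrent B β) E H ∧
    ∀ α, T α β = ∫ P in A, E P α

lemma integral_regionCurrent_pairing {A : Set Space} (hA : MeasurableSet A) (α : Fin 3)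
    (E : Space → CVec) : ∫ P, ∑ γ, regionCurrent A α P γ * E P γ = ∫ P in A, E P α := by
  rw [← integral_indicator hA]
  congr 1
  ext P
  by_cases h : P ∈ A <;> simp [regionCurrent_apply, h]

lemma integrableOn_apply {A : Set Space} (hA' : volume A ≠ ⊤) {E : Space → CVec}
    (hE : MemLp E 2) (α : Fin 3) : IntegrableOn (fun P => E P α) A := by
  have : IsFiniteMeasure (volume.restrict A) := ⟨by simpa using hA'.lt_top⟩
  exact ((memLp_apply hE α).restrict A).integrable (by norm_num)

lemma VerticalMirror.vec_apply_eq_sum (M : VerticalMirror) (v : CVec) (α : Fin 3) :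
    M.vec v α = ∑ δ, M.mat α δ * v δ := by
  fin_cases α <;>
  simp [VerticalMirror.vec_apply, VerticalMirror.mat, Fin.sum_univ_three, sub_eq_add_neg]

section Response

variable {σ : ℝ → ℂ} {ω μ₀ : ℝ} {A B A' B' : Set Space} {T T' : Tensor}

/-- Integrating a component over a region is pairing with the unit current of that region, so this
is reciprocity for two unit currents. -/
lemma IsResponse.reciprocity (hσ : IsDissipative σ) (hA : MeasurableSet A) (hA' : volume A ≠ ⊤)
    (hB : MeasurableSet B) (hB' : volume B ≠ ⊤) (h : IsResponse σ ω μ₀ A B T)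
    (h' : IsResponse σ ω μ₀ B A T') (α β : Fin 3) : T α β = T' β α := by
  obtain ⟨E, H, hE, e⟩ := h β
  obtain ⟨E', H', hE', e'⟩ := h' α
  rw [e, e', ← integral_regionCurrent_pairing hA, ← integral_regionCurrent_pairing hB]
  exact hE'.reciprocity hσ (memLp_regionCurrent hA hA' α) (memLp_regionCurrent hB hB' β) hE

/-- Linear combinations of the fields of three currents. -/
lemma IsFiniteEnergyField.linearCombination (hσ : IsDissipative σ) {J E H : Fin 3 → Space → CVec}
    (hJ : ∀ γ, MemLp (J γ) 2) (h : ∀ γ, IsFiniteEnergyField σ ω μ₀ (J γ) (E γ) (H γ))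
    (m : Fin 3 → ℂ) :
    IsFiniteEnergyField σ ω μ₀ (fun P => ∑ γ, m γ • J γ P) (fun P => ∑ γ, m γ • E γ P)
      (fun P => ∑ γ, m γ • H γ P) := by
  simp only [Fin.sum_univ_three]
  have k : ∀ γ, MemLp (fun P => m γ • J γ P) 2 := fun γ => memLp_const_smul (hJ γ) _
  exact (((h 0).const_smul (m 0)).add hσ ((h 1).const_smul (m 1)) (k 0) (k 1)).add hσ
    ((h 2).const_smul (m 2)) ((k 0).add (k 1)) (k 2)

/-- The reflected unit current is a combination of the unit currents of `B'` with coefficients from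
a column of `M.mat`. Uniqueness identifies the reflected field with the same combination of their
fields. Agreement of regions up to null sets suffices, as half-open boxes require. -/
lemma IsResponse.reflect (hσ : IsDissipative σ) (M : VerticalMirror) (hA : volume A ≠ ⊤)
    (hB₁ : MeasurableSet B) (hB : volume B ≠ ⊤) (hA' : volume A' ≠ ⊤)
    (hB₁' : MeasurableSet B') (hB' : volume B' ≠ ⊤) (h : IsResponse σ ω μ₀ A B T)
    (h' : IsResponse σ ω μ₀ A' B' T') (hAA' : M.map ⁻¹' A =ᵐ[volume] A')
    (hBB' : M.map ⁻¹' B =ᵐ[volume] B') : M.mat * T = T' * M.mat := by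
  ext α β
  obtain ⟨E, H, hE, e⟩ := h β
  choose E' H' hE' e' using h'
  have s1 := M.isFiniteEnergyField hE
  have s2 := IsFiniteEnergyField.linearCombination hσ
    (fun γ => memLp_regionCurrent hB₁' hB' γ) hE' (fun γ => M.mat γ β)
  have hJ : (fun P => ∑ γ, M.mat γ β • regionCurrent B' γ P) =ᵐ[volume]
      M.field (regionCurrent B β) := by
    filter_upwards [hBB'.mem_iff] with P hP
    ext α
    have : P ∈ B' ↔ M.map P ∈ B := hP.symm
    rw [VerticalMirror.field, VerticalMirror.vec_apply_eq_sum]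
    by_cases hm : M.map P ∈ B <;>
    simp [regionCurrent_apply, this, hm, Finset.sum_ite_eq]
  have hae := s1.ae_eq hσ (M.memLp_field (memLp_regionCurrent hB₁ hB β)) (s2.congr hJ)
  have i1 : ∫ P in A', M.field E P α = ∑ δ, M.mat α δ * T δ β := by
    rw [← setIntegral_congr_set hAA']
    simp only [VerticalMirror.field]
    rw [M.measurePreserving.setIntegral_preimage_emb M.measurableEmbedding
      (fun P => M.vec (E P) α)]
    simp only [VerticalMirror.vec_apply_eq_sum, e]
    rw [integral_finsetSum]
    · simp only [integral_const_mul]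
    · exact fun δ _ => (integrableOn_apply hA hE.1 δ).const_mul _
  have i2 : ∫ P in A', (∑ γ, M.mat γ β • E' γ P : CVec) α = ∑ γ, T' α γ * M.mat γ β := by
    simp only [WithLp.ofLp_sum, Finset.sum_apply, PiLp.smul_apply, smul_eq_mul, e']
    rw [integral_finsetSum]
    · simp only [integral_const_mul, mul_comm]
    · exact fun δ _ => (integrableOn_apply hA' (hE' δ).1 α).const_mul _
  rw [Matrix.mul_apply, Matrix.mul_apply, ← i1, ← i2]
  refine integral_congr_ae (ae_restrict_of_ae ?_)
  filter_upwards [hae] with P hP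
  rw [hP]

end Response

/-! ### The Green's tensor as a limit of averaged responses -/

lemma IsLossyGreenTensor.exists_field {σ : ℝ → ℂ} {S : Set ℝ} {ω μ₀ : ℝ}
    {G : Space → Space → Tensor} (hG : IsLossyGreenTensor σ S ω μ₀ G) {B : Set Space}
    (hB : MeasurableSet B) (hbd : Bornology.IsBounded B) (β : Fin 3) :
    ∃ E H : Space → CVec, IsFiniteEnergyField σ ω μ₀ (regionCurrent B β) E H ∧
      ∀ᵐ P, P ∉ closure B → ∀ α, IntegrableOn (fun P₀ => G P P₀ α β) B ∧
        E P α = ∫ P₀ in B, G P P₀ α β := by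
  have hs : Function.support (regionCurrent B β) ⊆ B := Set.support_indicator_subset
  have hc : HasCompactSupport (regionCurrent B β) :=
    HasCompactSupport.of_support_subset_isCompact hbd.isCompact_closure
      (hs.trans subset_closure)
  obtain ⟨E, H, hE, h⟩ := hG.2 _ (memLp_regionCurrent hB hbd.measure_lt_top.ne β) hc
  refine ⟨E, H, hE, ?_⟩
  filter_upwards [h] with P hP hPB α
  have e : (fun P₀ => ∑ β', G P P₀ α β' * regionCurrent B β P₀ β') =
      B.indicator fun P₀ => G P P₀ α β := by
    ext P₀
    by_cases hm : P₀ ∈ B <;> simp [regionCurrent_apply, hm]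
  obtain ⟨h1, h2⟩ := hP (fun hm => hPB (closure_mono hs hm)) α
  rw [e] at h1
  rw [h2, e]
  exact ⟨(integrable_indicator_iff hB).1 h1, integral_indicator hB⟩

lemma norm_setIntegral_sub_le {f : Space → ℂ} {A : Set Space} {g : ℂ} {C : ℝ}
    (hA : volume A ≠ ⊤) (hf : IntegrableOn f A) (h : ∀ᵐ P, P ∈ A → ‖f P - g‖ ≤ C) :
    ‖(∫ P in A, f P) - volume.real A * g‖ ≤ C * volume.real A := by
  have h1 := norm_setIntegral_le_of_norm_le_const_ae' hA.lt_top h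
  rwa [integral_sub hf (integrableOn_const hA), setIntegral_const, Complex.real_smul] at h1

/-- Upgrades continuity of the kernel on this set to continuity at each of its points; finiteness of
`S` keeps the interfaces closed. -/
lemma isOpen_offDiagonal {S : Set ℝ} (hS : S.Finite) :
    IsOpen {p : Space × Space | OffDiagonal S p.1 p.2} := by
  have h1 : IsOpen {p : Space × Space | p.1 ≠ p.2} := isOpen_ne_fun continuous_fst continuous_snd
  have h2 : IsOpen {p : Space × Space | p.1 2 ∉ S} :=
    hS.isClosed.isOpen_compl.preimage (f := fun p : Space × Space => p.1 2) (by fun_prop)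
  have h3 : IsOpen {p : Space × Space | p.2 2 ∉ S} :=
    hS.isClosed.isOpen_compl.preimage (f := fun p : Space × Space => p.2 2) (by fun_prop)
  exact h1.inter (h2.inter h3)

/-- The volume of a ball of radius `r`. -/
def ballVolume (r : ℝ) : ℝ := volume.real (Metric.closedBall (0 : Space) r)

lemma real_closedBall (P : Space) (r : ℝ) :
    volume.real (Metric.closedBall P r) = ballVolume r := by
  rw [ballVolume, measureReal_def, measureReal_def, Measure.addHaar_closedBall_center]

lemma ballVolume_pos {r : ℝ} (hr : 0 < r) : 0 < ballVolume r :=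
  ENNReal.toReal_pos (Metric.measure_closedBall_pos volume _ hr).ne'
    (measure_closedBall_lt_top).ne

/-- The kernel is tied to fields only almost everywhere. By continuity, averaging over small balls
around both points recovers its value, which carries identities of responses over to points. -/
lemma IsLossyGreenTensor.exists_tendsto_response {σ : ℝ → ℂ} {S : Set ℝ} (hS : S.Finite)
    {ω μ₀ : ℝ} {G : Space → Space → Tensor} (hG : IsLossyGreenTensor σ S ω μ₀ G) {P P₀ : Space}
    (hP : OffDiagonal S P P₀) :
    ∃ T : ℝ → Tensor,
      (∀ r, IsResponse σ ω μ₀ (Metric.closedBall P r) (Metric.closedBall P₀ r) (T r)) ∧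
      Tendsto (fun r => ((ballVolume r : ℂ) ^ 2)⁻¹ • T r) (𝓝[>] 0) (𝓝 (G P P₀)) := by
  choose E H hE hEG using fun r β => hG.exists_field
    (B := Metric.closedBall P₀ r) measurableSet_closedBall Metric.isBounded_closedBall β
  refine ⟨fun r => Matrix.of fun α β => ∫ Q in Metric.closedBall P r, E r β Q α,
    fun r β => ⟨E r β, H r β, hE r β, fun α => rfl⟩, ?_⟩
  refine tendsto_pi_nhds.2 fun α => tendsto_pi_nhds.2 fun β => ?_
  rw [Metric.tendsto_nhds]
  intro ε hε
  have hopen := (isOpen_offDiagonal hS).mem_nhds (show (P, P₀) ∈ _ from hP)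
  have hcont : ContinuousAt (fun p : Space × Space => G p.1 p.2 α β) (P, P₀) := by
    have := (hG.1.continuousAt hopen)
    exact ((continuous_apply β).comp (continuous_apply α)).continuousAt.comp this
  have hev := (hcont.eventually (Metric.closedBall_mem_nhds (G P P₀ α β) (half_pos hε))).and hopen
  obtain ⟨δ, hδ, hball⟩ := Metric.eventually_nhds_iff.1 hev
  filter_upwards [Ioo_mem_nhdsGT hδ] with r hr
  -- For small `r` the two balls are also disjoint, so the kernel formula for the field holds on the
  -- receiver ball.
  have hclose : ∀ Q ∈ Metric.closedBall P r, ∀ Q₀ ∈ Metric.closedBall P₀ r,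
      ‖G Q Q₀ α β - G P P₀ α β‖ ≤ ε / 2 ∧ Q ≠ Q₀ := by
    intro Q hQ Q₀ hQ₀
    have h := hball (y := (Q, Q₀)) (by
      rw [Prod.dist_eq]
      exact (max_le (Metric.mem_closedBall.1 hQ) (Metric.mem_closedBall.1 hQ₀)).trans_lt hr.2)
    exact ⟨by simpa [dist_eq_norm] using h.1, h.2.1⟩
  set v := ballVolume r with hv
  have hvpos : 0 < v := ballVolume_pos hr.1
  have hfin : ∀ Q : Space, volume (Metric.closedBall Q r) ≠ ⊤ :=
    fun Q => measure_closedBall_lt_top.ne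
  have h1 : ∀ᵐ Q, Q ∈ Metric.closedBall P r → ‖E r β Q α - v * G P P₀ α β‖ ≤ ε / 2 * v := by
    filter_upwards [hEG r β] with Q hQ hQP
    obtain ⟨hi, he⟩ := hQ (by
      rw [Metric.isClosed_closedBall.closure_eq]
      exact fun hm => (hclose Q hQP Q hm).2 rfl) α
    rw [he, hv, ← real_closedBall P₀ r]
    exact norm_setIntegral_sub_le (hfin P₀) hi
      (ae_of_all _ fun Q₀ hQ₀ => (hclose Q hQP Q₀ hQ₀).1)
  have h2 := norm_setIntegral_sub_le (hfin P) (integrableOn_apply (hfin P) (hE r β).1 α) h1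
  rw [real_closedBall P r, ← hv] at h2
  have hvc : (v : ℂ) ≠ 0 := by exact_mod_cast hvpos.ne'
  rw [dist_eq_norm]
  simp only [Matrix.smul_apply, Matrix.of_apply, smul_eq_mul]
  have e : ((v : ℂ) ^ 2)⁻¹ * (∫ Q in Metric.closedBall P r, E r β Q α) - G P P₀ α β =
      ((v : ℂ) ^ 2)⁻¹ *
        ((∫ Q in Metric.closedBall P r, E r β Q α) - v * (v * G P P₀ α β)) := by
    field_simp
  refine lt_of_eq_of_lt (congrArg norm e) ?_
  rw [norm_mul, norm_inv, norm_pow, Complex.norm_real, Real.norm_of_nonneg hvpos.le]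
  refine (mul_le_mul_of_nonneg_left h2 (by positivity)).trans_lt ?_
  have : (v ^ 2)⁻¹ * (ε / 2 * v * v) = ε / 2 := by field_simp
  rw [this]
  linarith

lemma VerticalMirror.preimage_closedBall (M : VerticalMirror) (P : Space) (r : ℝ) :
    M.map ⁻¹' Metric.closedBall P r = Metric.closedBall (M.map P) r := by
  ext Q
  rw [Set.mem_preimage, Metric.mem_closedBall, Metric.mem_closedBall,
    ← M.isometry_map.dist_eq (M.map Q) P, M.map_map]

lemma VerticalMirror.map_ne (M : VerticalMirror) {P P₀ : Space} (h : P ≠ P₀) :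
    M.map P ≠ M.map P₀ := fun e => h (by rw [← M.map_map P, e, M.map_map])

lemma OffDiagonal.mirror {S : Set ℝ} {P P₀ : Space} (h : OffDiagonal S P P₀)
    (M : VerticalMirror) : OffDiagonal S (M.map P) (M.map P₀) := by
  refine ⟨M.map_ne h.1, ?_, ?_⟩ <;> rw [M.map_two]
  exacts [h.2.1, h.2.2]

lemma OffDiagonal.symm {S : Set ℝ} {P P₀ : Space} (h : OffDiagonal S P P₀) :
    OffDiagonal S P₀ P := ⟨h.1.symm, h.2.2, h.2.1⟩

/-! ### Reflection and reciprocity of the kernel of a dissipative profile. -/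

section

variable {σ : ℝ → ℂ} {S : Set ℝ} {ω μ₀ : ℝ} {G : Space → Space → Tensor}

lemma IsLossyGreenTensor.reflect (hσ : IsDissipative σ) (hS : S.Finite)
    (hG : IsLossyGreenTensor σ S ω μ₀ G) {P P₀ : Space} (hP : OffDiagonal S P P₀)
    (M : VerticalMirror) : M.mat * G P P₀ = G (M.map P) (M.map P₀) * M.mat := by
  obtain ⟨T, hT, hTG⟩ := hG.exists_tendsto_response hS hP
  obtain ⟨T', hT', hTG'⟩ := hG.exists_tendsto_response hS (hP.mirror M)
  have e : ∀ r, M.mat * T r = T' r * M.mat := fun r =>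
    (hT r).reflect hσ M measure_closedBall_lt_top.ne measurableSet_closedBall
      measure_closedBall_lt_top.ne measure_closedBall_lt_top.ne measurableSet_closedBall
      measure_closedBall_lt_top.ne (hT' r) (by rw [M.preimage_closedBall]; exact ae_eq_refl _)
      (by rw [M.preimage_closedBall]; exact ae_eq_refl _)
  refine tendsto_nhds_unique (tendsto_const_nhds.mul hTG) ((hTG'.mul tendsto_const_nhds).congr
    fun r => ?_)
  rw [Matrix.mul_smul, e, Matrix.smul_mul]

lemma IsLossyGreenTensor.reciprocity (hσ : IsDissipative σ) (hS : S.Finite)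
    (hG : IsLossyGreenTensor σ S ω μ₀ G) {P P₀ : Space} (hP : OffDiagonal S P P₀) :
    (G P P₀).transpose = G P₀ P := by
  obtain ⟨T, hT, hTG⟩ := hG.exists_tendsto_response hS hP
  obtain ⟨T', hT', hTG'⟩ := hG.exists_tendsto_response hS hP.symm
  have e : ∀ r, (T r).transpose = T' r := fun r => by
    ext α β
    exact (hT r).reciprocity hσ measurableSet_closedBall measure_closedBall_lt_top.ne
      measurableSet_closedBall measure_closedBall_lt_top.ne (hT' r) β α
  refine tendsto_nhds_unique ((continuous_id.matrix_transpose.tendsto _).comp hTG)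
    (hTG'.congr fun r => ?_)
  simp [← e]

end

lemma LayeredMedium.finite_interfaces (L : LayeredMedium) : L.interfaces.Finite :=
  Set.finite_range _

lemma LayeredMedium.RegularPair.mirror {L : LayeredMedium} {P P₀ : Space}
    (h : L.RegularPair P P₀) (M : VerticalMirror) : L.RegularPair (M.map P) (M.map P₀) := by
  refine ⟨h.1.mirror M, ?_⟩
  rw [M.map_two, M.map_two]
  exact h.2

lemma LayeredMedium.RegularPair.symm {L : LayeredMedium} {P P₀ : Space}
    (h : L.RegularPair P P₀) : L.RegularPair P₀ P := ⟨h.1.symm, h.2.symm⟩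

/-! ### Passage to general media by limiting absorption. -/

section

variable {L : LayeredMedium} {ω μ₀ : ℝ} {G : Space → Space → Tensor}

lemma LayeredMedium.IsElectricGreenTensor.reflect (hG : L.IsElectricGreenTensor ω μ₀ G)
    {P P₀ : Space} (hP : L.RegularPair P P₀) (M : VerticalMirror) :
    M.mat * G P P₀ = G (M.map P) (M.map P₀) * M.mat := by
  by_cases hL : L.IsLossy
  · exact (hG.1 hL).reflect hL.isDissipative L.finite_interfaces hP.1 M
  · obtain ⟨Gε, h1, h2⟩ := hG.2 hL
    refine tendsto_nhds_unique_of_eventuallyEq (tendsto_const_nhds.mul (h2 _ _ hP))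
      ((h2 _ _ (hP.mirror M)).mul tendsto_const_nhds) ?_
    filter_upwards [self_mem_nhdsWithin] with ε hε
    exact (h1 ε hε).reflect (L.isDissipative_add hε) L.finite_interfaces hP.1 M

lemma LayeredMedium.IsElectricGreenTensor.reciprocity (hG : L.IsElectricGreenTensor ω μ₀ G)
    {P P₀ : Space} (hP : L.RegularPair P P₀) (α β : Fin 3) : G P P₀ α β = G P₀ P β α := by
  have key : (G P P₀).transpose = G P₀ P := by
    by_cases hL : L.IsLossy
    · exact (hG.1 hL).reciprocity hL.isDissipative L.finite_interfaces hP.1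
    · obtain ⟨Gε, h1, h2⟩ := hG.2 hL
      refine tendsto_nhds_unique_of_eventuallyEq
        ((continuous_id.matrix_transpose.tendsto _).comp (h2 _ _ hP)) (h2 _ _ hP.symm) ?_
      filter_upwards [self_mem_nhdsWithin] with ε hε
      exact (h1 ε hε).reciprocity (L.isDissipative_add hε) L.finite_interfaces hP.1
  rw [← key, Matrix.transpose_apply]

end

/-! ### Coordinate mirrors and the symmetries of the Green's tensor -/

namespace VerticalMirror

/-- The reflection `x ↦ a - x`. -/
def mirrorX (a : ℝ) : VerticalMirror := ⟨-1, 0, a, 0, by norm_num, by ring, by ring⟩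

/-- The reflection `y ↦ b - y`. -/
def mirrorY (b : ℝ) : VerticalMirror := ⟨1, 0, 0, b, by norm_num, by ring, by ring⟩

/-- The signs of the components under `x ↦ a - x`. -/
def signX : Fin 3 → ℂ := ![-1, 1, 1]

/-- The signs of the components under `y ↦ b - y`. -/
def signY : Fin 3 → ℂ := ![1, -1, 1]

lemma mirrorX_map (a x y z : ℝ) : (mirrorX a).map !₂[x, y, z] = !₂[a - x, y, z] := by
  ext i
  fin_cases i <;> simp [map_apply, mirrorX]
  ring

lemma mirrorY_map (b x y z : ℝ) : (mirrorY b).map !₂[x, y, z] = !₂[x, b - y, z] := by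
  ext i
  fin_cases i <;> simp [map_apply, mirrorY]
  ring

lemma mirrorX_mat (a : ℝ) : (mirrorX a).mat = Matrix.diagonal signX := by
  ext i j
  fin_cases i <;> fin_cases j <;> simp [mat, mirrorX, signX]

lemma mirrorY_mat (b : ℝ) : (mirrorY b).mat = Matrix.diagonal signY := by
  ext i j
  fin_cases i <;> fin_cases j <;> simp [mat, mirrorY, signY]

lemma entry_eq_of_diagonal {d : Fin 3 → ℂ} (hd : ∀ i, d i * d i = 1) {T T' : Tensor}
    (h : Matrix.diagonal d * T = T' * Matrix.diagonal d) (α β : Fin 3) :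
    T' α β = d α * d β * T α β := by
  have h1 := congrFun (congrFun h α) β
  rw [Matrix.diagonal_mul, Matrix.mul_diagonal] at h1
  linear_combination -d β * h1 - T' α β * hd β

lemma signX_mul_self (i : Fin 3) : signX i * signX i = 1 := by
  fin_cases i <;> simp [signX]

lemma signY_mul_self (i : Fin 3) : signY i * signY i = 1 := by
  fin_cases i <;> simp [signY]

/-- Two points lie in a common vertical plane. -/
lemma exists_map_eq_self (P P₀ : Space) :
    ∃ M : VerticalMirror, M.map P = P ∧ M.map P₀ = P₀ := by
  obtain ⟨c, s, hu, h1, h2⟩ : ∃ c s : ℝ, c ^ 2 + s ^ 2 = 1 ∧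
      c * (P 0 - P₀ 0) + s * (P 1 - P₀ 1) = P 0 - P₀ 0 ∧
      s * (P 0 - P₀ 0) - c * (P 1 - P₀ 1) = P 1 - P₀ 1 := by
    generalize P 0 - P₀ 0 = ξ
    generalize P 1 - P₀ 1 = η
    by_cases h : ξ ^ 2 + η ^ 2 = 0
    · have h1 : ξ = 0 := by nlinarith [sq_nonneg ξ, sq_nonneg η]
      have h2 : η = 0 := by nlinarith [sq_nonneg ξ, sq_nonneg η]
      -- Points on one vertical line: any vertical plane through it serves.
      exact ⟨1, 0, by norm_num, by simp [h1], by simp [h1, h2]⟩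
    -- The cosine and sine of twice the polar angle of `(ξ, η)`: reflection in the line spanned by
    -- the offset.
    · exact ⟨(ξ ^ 2 - η ^ 2) / (ξ ^ 2 + η ^ 2), 2 * ξ * η / (ξ ^ 2 + η ^ 2),
        by field_simp; ring, by field_simp; ring, by field_simp; ring⟩
  -- The translation is chosen so that `P₀` is fixed; `P` is then fixed because the offset is.
  refine ⟨⟨c, s, P₀ 0 - c * P₀ 0 - s * P₀ 1, P₀ 1 - s * P₀ 0 + c * P₀ 1, hu,
    by linear_combination -P₀ 0 * hu, by linear_combination -P₀ 1 * hu⟩, ?_, ?_⟩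
  · ext i
    fin_cases i
    · simp only [map_apply, Fin.zero_eta, Fin.isValue, Matrix.cons_val_zero]
      linear_combination h1
    · simp only [map_apply, Fin.mk_one, Fin.isValue, Matrix.cons_val_one, Matrix.cons_val_zero]
      linear_combination h2
    · simp [map_apply]
  · ext i
    fin_cases i
    · simp only [map_apply, Fin.zero_eta, Fin.isValue, Matrix.cons_val_zero]
      ring
    · simp only [map_apply, Fin.mk_one, Fin.isValue, Matrix.cons_val_one, Matrix.cons_val_zero]
      ring
    · simp [map_apply]

/-- A horizontal `2 × 2` block that commutes with a planar reflection is a combination of the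
identity and that reflection, both of which are symmetric. -/
lemma entry_symm_of_commute (M : VerticalMirror) {T : Tensor} (h : M.mat * T = T * M.mat) :
    T 0 1 = T 1 0 := by
  have hu : (M.c : ℂ) ^ 2 + (M.s : ℂ) ^ 2 = 1 := by exact_mod_cast M.unit
  have h00 := congrFun (congrFun h 0) 0
  have h01 := congrFun (congrFun h 0) 1
  have h10 := congrFun (congrFun h 1) 0
  simp only [Matrix.mul_apply, Fin.sum_univ_three, mat, Fin.isValue, Matrix.of_apply,
    Matrix.cons_val_zero, Matrix.cons_val_one, Matrix.cons_val] at h00 h01 h10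
  linear_combination (M.c : ℂ) / 2 * h01 + (M.c : ℂ) / 2 * h10 - M.s * h00 +
    (T 1 0 - T 0 1) * hu

end VerticalMirror

open VerticalMirror

/-! ### Symmetries of the kernel in lateral offsets and heights. -/

section

variable {L : LayeredMedium} {ω μ₀ : ℝ} {G : Space → Space → Tensor}

lemma LayeredMedium.IsElectricGreenTensor.entry_symm (hG : L.IsElectricGreenTensor ω μ₀ G)
    {P P₀ : Space} (hP : L.RegularPair P P₀) : G P P₀ 0 1 = G P P₀ 1 0 := by
  obtain ⟨M, h1, h2⟩ := exists_map_eq_self P P₀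
  have h := hG.reflect hP M
  rw [h1, h2] at h
  exact M.entry_symm_of_commute h

lemma LayeredMedium.RegularPair.mirrorX {x y z x₀ y₀ z₀ : ℝ}
    (h : L.RegularPair !₂[x, y, z] !₂[x₀, y₀, z₀]) (a : ℝ) :
    L.RegularPair !₂[a - x, y, z] !₂[a - x₀, y₀, z₀] := by
  simpa only [mirrorX_map] using h.mirror (VerticalMirror.mirrorX a)

lemma LayeredMedium.RegularPair.mirrorY {x y z x₀ y₀ z₀ : ℝ}
    (h : L.RegularPair !₂[x, y, z] !₂[x₀, y₀, z₀]) (b : ℝ) :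
    L.RegularPair !₂[x, b - y, z] !₂[x₀, b - y₀, z₀] := by
  simpa only [mirrorY_map] using h.mirror (VerticalMirror.mirrorY b)

lemma LayeredMedium.RegularPair.lateral {x y z x₀ y₀ z₀ : ℝ}
    (h : L.RegularPair !₂[x, y, z] !₂[x₀, y₀, z₀]) :
    L.RegularPair !₂[x - x₀, y - y₀, z] !₂[0, 0, z₀] := by
  simpa using (((h.mirrorX x₀).mirrorX 0).mirrorY y₀).mirrorY 0

/-- The half-turn about the vertical axis midway between the points exchanges their lateral
positions. -/
lemma LayeredMedium.RegularPair.swap {ξ η z z₀ : ℝ}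
    (h : L.RegularPair !₂[ξ, η, z] !₂[0, 0, z₀]) :
    L.RegularPair !₂[ξ, η, z₀] !₂[0, 0, z] := by
  simpa using (h.symm.mirrorX ξ).mirrorY η

namespace LayeredMedium.IsElectricGreenTensor

lemma entry_mirrorX (hG : L.IsElectricGreenTensor ω μ₀ G) {x y z x₀ y₀ z₀ : ℝ}
    (h : L.RegularPair !₂[x, y, z] !₂[x₀, y₀, z₀]) (a : ℝ) (α β : Fin 3) :
    G !₂[a - x, y, z] !₂[a - x₀, y₀, z₀] α β =
      signX α * signX β * G !₂[x, y, z] !₂[x₀, y₀, z₀] α β := by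
  have := hG.reflect h (mirrorX a)
  rw [mirrorX_mat, mirrorX_map, mirrorX_map] at this
  exact entry_eq_of_diagonal signX_mul_self this α β

lemma entry_mirrorY (hG : L.IsElectricGreenTensor ω μ₀ G) {x y z x₀ y₀ z₀ : ℝ}
    (h : L.RegularPair !₂[x, y, z] !₂[x₀, y₀, z₀]) (b : ℝ) (α β : Fin 3) :
    G !₂[x, b - y, z] !₂[x₀, b - y₀, z₀] α β =
      signY α * signY β * G !₂[x, y, z] !₂[x₀, y₀, z₀] α β := by
  have := hG.reflect h (mirrorY b)
  rw [mirrorY_mat, mirrorY_map, mirrorY_map] at this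
  exact entry_eq_of_diagonal signY_mul_self this α β

/-- Two parallel mirrors in each lateral direction make the translation by `(-x₀, -y₀)`; every sign
occurs twice and cancels. -/
lemma eq_lateralForm (hG : L.IsElectricGreenTensor ω μ₀ G) {x y z x₀ y₀ z₀ : ℝ}
    (h : L.RegularPair !₂[x, y, z] !₂[x₀, y₀, z₀]) :
    G !₂[x, y, z] !₂[x₀, y₀, z₀] = lateralForm G (x - x₀) (y - y₀) z z₀ := by
  ext α β
  have e1 := hG.entry_mirrorX h x₀ α β
  have e2 := hG.entry_mirrorX (h.mirrorX x₀) 0 α β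
  have e3 := hG.entry_mirrorY ((h.mirrorX x₀).mirrorX 0) y₀ α β
  have e4 := hG.entry_mirrorY (((h.mirrorX x₀).mirrorX 0).mirrorY y₀) 0 α β
  rw [e3, e2, e1] at e4
  simp only [sub_self, zero_sub, neg_sub] at e4
  rw [lateralForm, e4]
  linear_combination (-G !₂[x, y, z] !₂[x₀, y₀, z₀] α β) *
    (signY β * signY β * signX α * signX α * signX β * signX β * signY_mul_self α +
      signX α * signX α * signX β * signX β * signY_mul_self β +
      signX β * signX β * signX_mul_self α + signX_mul_self β)

/-- Reciprocity exchanges points and indices; the half-turn then restores the lateral positions, so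
only the heights stay exchanged. The factor is `-1` exactly when one of the two indices is vertical.
-/
lemma lateralForm_swap (hG : L.IsElectricGreenTensor ω μ₀ G) {ξ η z z₀ : ℝ}
    (h : L.RegularPair !₂[ξ, η, z] !₂[0, 0, z₀]) (α β : Fin 3) :
    lateralForm G ξ η z₀ z β α =
      signX α * signX β * (signY α * signY β) * lateralForm G ξ η z z₀ α β := by
  have e1 := hG.entry_mirrorX h.symm ξ β α
  have e2 := hG.entry_mirrorY (h.symm.mirrorX ξ) η β α
  rw [e1, ← hG.reciprocity h] at e2
  simp only [sub_self, sub_zero] at e2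
  rw [lateralForm, lateralForm, e2]
  ring

end LayeredMedium.IsElectricGreenTensor

end

/-! ### The Galerkin matrix -/

lemma ae_coord_ne (i : Fin 3) (c : ℝ) : ∀ᵐ P : Space, P i ≠ c :=
  (PiLp.volume_preserving_ofLp (Fin 3)).quasiMeasurePreserving.ae
    (Measure.ae_eval_ne (μ := fun _ => volume) i c)

lemma ae_coord_notMem (i : Fin 3) {S : Set ℝ} (hS : S.Finite) : ∀ᵐ P : Space, P i ∉ S := by
  filter_upwards [(ae_ball_iff hS.countable).2 fun c _ => ae_coord_ne i c] with P hP hm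
  exact hP _ hm rfl

section Cells

variable {Nx Ny Nz : ℕ} (g : Grid Nx Ny Nz)

lemma Grid.measurableSet_cell (n : CellIndex Nx Ny Nz) : MeasurableSet (g.cell n) :=
  (measurableSet_Ico.preimage (measurable_coord 0)).inter
    ((measurableSet_Ico.preimage (measurable_coord 1)).inter
      (measurableSet_Ico.preimage (measurable_coord 2)))

lemma Grid.isBounded_cell (n : CellIndex Nx Ny Nz) : Bornology.IsBounded (g.cell n) := by
  let K : Set (Fin 3 → ℝ) := Set.Icc
    ![g.x₀ + g.hx * (n.1 : ℕ), g.y₀ + g.hy * (n.2.1 : ℕ), g.node n.2.2.castSucc]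
    ![g.x₀ + g.hx * ((n.1 : ℕ) + 1), g.y₀ + g.hy * ((n.2.1 : ℕ) + 1), g.node n.2.2.succ]
  have hK : IsCompact K := isCompact_Icc
  refine (hK.image (PiLp.continuous_toLp 2 _)).isBounded.subset fun P hP => ⟨P.ofLp, ?_, rfl⟩
  obtain ⟨h0, h1, h2⟩ := hP
  constructor <;> intro i <;> fin_cases i
  exacts [h0.1, h1.1, h2.1, h0.2.le, h1.2.le, h2.2.le]

lemma Grid.volume_cell_ne_top (n : CellIndex Nx Ny Nz) : volume (g.cell n) ≠ ⊤ :=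
  (g.isBounded_cell n).measure_lt_top.ne

lemma Grid.closure_cell_subset (n : CellIndex Nx Ny Nz) :
    closure (g.cell n) ⊆
      {P | P 0 ∈ Set.Icc (g.x₀ + g.hx * (n.1 : ℕ)) (g.x₀ + g.hx * ((n.1 : ℕ) + 1))} :=
  closure_minimal (fun _ hP => ⟨hP.1.1, hP.1.2.le⟩)
    (isClosed_Icc.preimage (f := fun P : Space => P 0) (by fun_prop))

lemma Grid.ae_notMem_closure_cell {n m : CellIndex Nx Ny Nz} (h : n.1 ≠ m.1) :
    ∀ᵐ P, P ∈ g.cell n → P ∉ closure (g.cell m) := by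
  -- Of the half-open box `n` only the left face can meet the closure of a box in another column,
  -- and that face is null.
  filter_upwards [ae_coord_ne 0 (g.x₀ + g.hx * (n.1 : ℕ))] with P hne hP hPm
  have h1 := hP.1
  have h2 := g.closure_cell_subset m hPm
  have hx := g.hx_pos
  rcases lt_or_gt_of_ne (fun e => h (Fin.ext e) : (n.1 : ℕ) ≠ (m.1 : ℕ)) with hlt | hlt
  · have h3 : ((n.1 : ℕ) : ℝ) + 1 ≤ ((m.1 : ℕ) : ℝ) := by exact_mod_cast hlt
    have := mul_le_mul_of_nonneg_left h3 hx.le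
    linarith [h1.2, h2.1]
  · have h3 : ((m.1 : ℕ) : ℝ) + 1 ≤ ((n.1 : ℕ) : ℝ) := by exact_mod_cast hlt
    have := mul_le_mul_of_nonneg_left h3 hx.le
    exact hne (le_antisymm (by linarith [h2.2]) h1.1)

/-- The reflection `t ↦ 2o + h(p + 1) - t` exchanges intervals whose indices add up to `p`. It moves
the closed end to the other side, so the endpoints are excluded. -/
lemma mem_Ico_sub_iff {o h t : ℝ} {p k k' : ℕ} (hk : k + k' = p) (h1 : t ≠ o + h * k')
    (h2 : t ≠ o + h * (k' + 1)) :
    2 * o + h * (p + 1) - t ∈ Set.Ico (o + h * k) (o + h * (k + 1)) ↔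
      t ∈ Set.Ico (o + h * k') (o + h * (k' + 1)) := by
  have hp : (p : ℝ) = k + k' := by exact_mod_cast hk.symm
  rw [Set.mem_Ico, Set.mem_Ico, hp]
  constructor
  · rintro ⟨h3, h4⟩
    exact ⟨by linarith, lt_of_le_of_ne (by linarith) h2⟩
  · rintro ⟨h3, h4⟩
    exact ⟨by linarith, by linarith [lt_of_le_of_ne h3 h1.symm]⟩

lemma Grid.preimage_cell_mirrorX {p : ℕ} {a a' : Fin Nx} (h : (a : ℕ) + (a' : ℕ) = p)
    (q : Fin Ny × Fin Nz) :
    (VerticalMirror.mirrorX (2 * g.x₀ + g.hx * (p + 1))).map ⁻¹' g.cell (a, q)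
      =ᵐ[volume] g.cell (a', q) := by
  filter_upwards [ae_coord_ne 0 (g.x₀ + g.hx * (a' : ℕ)),
    ae_coord_ne 0 (g.x₀ + g.hx * ((a' : ℕ) + 1))] with P h1 h2
  have e : (VerticalMirror.mirrorX (2 * g.x₀ + g.hx * (p + 1))).map P =
      !₂[2 * g.x₀ + g.hx * (p + 1) - P 0, P 1, P 2] := by
    rw [← VerticalMirror.mirrorX_map]
    congr 1
    ext i; fin_cases i <;> rfl
  refine propext ?_
  change (VerticalMirror.mirrorX _).map P ∈ g.cell (a, q) ↔ P ∈ g.cell (a', q)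
  rw [e]
  exact and_congr (mem_Ico_sub_iff h h1 h2) Iff.rfl

lemma Grid.preimage_cell_mirrorY {p : ℕ} {b b' : Fin Ny} (h : (b : ℕ) + (b' : ℕ) = p)
    (a : Fin Nx) (c : Fin Nz) :
    (VerticalMirror.mirrorY (2 * g.y₀ + g.hy * (p + 1))).map ⁻¹' g.cell (a, b, c)
      =ᵐ[volume] g.cell (a, b', c) := by
  filter_upwards [ae_coord_ne 1 (g.y₀ + g.hy * (b' : ℕ)),
    ae_coord_ne 1 (g.y₀ + g.hy * ((b' : ℕ) + 1))] with P h1 h2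
  have e : (VerticalMirror.mirrorY (2 * g.y₀ + g.hy * (p + 1))).map P =
      !₂[P 0, 2 * g.y₀ + g.hy * (p + 1) - P 1, P 2] := by
    rw [← VerticalMirror.mirrorY_map]
    congr 1
    ext i; fin_cases i <;> rfl
  refine propext ?_
  change (VerticalMirror.mirrorY _).map P ∈ g.cell (a, b, c) ↔ P ∈ g.cell (a, b', c)
  rw [e]
  exact and_congr Iff.rfl (and_congr (mem_Ico_sub_iff h h1 h2) Iff.rfl)

end Cells

open VerticalMirror

/-- The symmetries of the Galerkin blocks: reciprocity, the reflections in the lateral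
coordinates, and the symmetry of the lateral components. -/
structure GalerkinSymmetry {Nx Ny Nz : ℕ}
    (B : CellIndex Nx Ny Nz → CellIndex Nx Ny Nz → Tensor) : Prop where
  reciprocity : ∀ n m α β, B n m α β = B m n β α
  -- Equal index sums mean that a single mirror exchanges `a` with `a'` and `d` with `d'`.
  mirrorX : ∀ (a a' d d' : Fin Nx) q r α β, (a : ℕ) + (a' : ℕ) = d + d' →
    B (a', q) (d', r) α β = signX α * signX β * B (a, q) (d, r) α β
  mirrorY : ∀ (b b' e e' : Fin Ny) a c d f α β, (b : ℕ) + (b' : ℕ) = e + e' →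
    B (a, b', c) (d, e', f) α β = signY α * signY β * B (a, b, c) (d, e, f) α β
  entry_symm : ∀ n m, B n m 0 1 = B n m 1 0

lemma IsLossyGreenTensor.entry_symm {σ : ℝ → ℂ} {S : Set ℝ} {ω μ₀ : ℝ}
    {G : Space → Space → Tensor} (hσ : IsDissipative σ) (hS : S.Finite)
    (hG : IsLossyGreenTensor σ S ω μ₀ G) {P P₀ : Space} (hP : OffDiagonal S P P₀) :
    G P P₀ 0 1 = G P P₀ 1 0 := by
  obtain ⟨M, h1, h2⟩ := exists_map_eq_self P P₀
  have h := hG.reflect hσ hS hP M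
  rw [h1, h2] at h
  exact M.entry_symm_of_commute h

/-! ### Symmetries of the Galerkin blocks and passage to the limit. -/

section

variable {σ : ℝ → ℂ} {S : Set ℝ} {ω μ₀ : ℝ} {G : Space → Space → Tensor} {Nx Ny Nz : ℕ}
  {g : Grid Nx Ny Nz} {B : CellIndex Nx Ny Nz → CellIndex Nx Ny Nz → Tensor}

lemma IsLossyGalerkinMatrix.isResponse (hB : IsLossyGalerkinMatrix σ ω μ₀ g B)
    (n m : CellIndex Nx Ny Nz) : IsResponse σ ω μ₀ (g.cell n) (g.cell m) (B n m) := fun β => by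
  obtain ⟨E, H, hE, h⟩ := hB m β
  exact ⟨E, H, hE, h n⟩

lemma IsLossyGalerkinMatrix.reflect (hσ : IsDissipative σ)
    (hB : IsLossyGalerkinMatrix σ ω μ₀ g B) (M : VerticalMirror) {n m n' m' : CellIndex Nx Ny Nz}
    (hn : M.map ⁻¹' g.cell n =ᵐ[volume] g.cell n')
    (hm : M.map ⁻¹' g.cell m =ᵐ[volume] g.cell m') : M.mat * B n m = B n' m' * M.mat :=
  (hB.isResponse n m).reflect hσ M (g.volume_cell_ne_top _) (g.measurableSet_cell _)
    (g.volume_cell_ne_top _) (g.volume_cell_ne_top _) (g.measurableSet_cell _)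
    (g.volume_cell_ne_top _) (hB.isResponse n' m') hn hm

lemma IsLossyGalerkinMatrix.entry_mirrorX (hσ : IsDissipative σ)
    (hB : IsLossyGalerkinMatrix σ ω μ₀ g B) (a a' d d' : Fin Nx) (q r : Fin Ny × Fin Nz)
    (α β : Fin 3) (h : (a : ℕ) + (a' : ℕ) = d + d') :
    B (a', q) (d', r) α β = signX α * signX β * B (a, q) (d, r) α β := by
  have e := hB.reflect hσ _ (g.preimage_cell_mirrorX h q) (g.preimage_cell_mirrorX rfl r)
  rw [mirrorX_mat] at e
  exact entry_eq_of_diagonal signX_mul_self e α β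

lemma IsLossyGalerkinMatrix.entry_mirrorY (hσ : IsDissipative σ)
    (hB : IsLossyGalerkinMatrix σ ω μ₀ g B) (b b' e e' : Fin Ny) (a : Fin Nx) (c : Fin Nz)
    (d : Fin Nx) (f : Fin Nz) (α β : Fin 3) (h : (b : ℕ) + (b' : ℕ) = e + e') :
    B (a, b', c) (d, e', f) α β = signY α * signY β * B (a, b, c) (d, e, f) α β := by
  have k := hB.reflect hσ _ (g.preimage_cell_mirrorY h a c) (g.preimage_cell_mirrorY rfl d f)
  rw [mirrorY_mat] at k
  exact entry_eq_of_diagonal signY_mul_self k α β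

/-- Away from the own column of a box, its field is the integral of the kernel. -/
lemma IsLossyGalerkinMatrix.eq_integral_kernel (hσ : IsDissipative σ)
    (hG : IsLossyGreenTensor σ S ω μ₀ G) (hB : IsLossyGalerkinMatrix σ ω μ₀ g B)
    {n m : CellIndex Nx Ny Nz} (h : n.1 ≠ m.1) (α β : Fin 3) :
    B n m α β = ∫ P in g.cell n, ∫ P₀ in g.cell m, G P P₀ α β := by
  obtain ⟨E, H, hE, e⟩ := hB m β
  obtain ⟨E', H', hE', e'⟩ := hG.exists_field (g.measurableSet_cell m) (g.isBounded_cell m) β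
  rw [e]
  refine setIntegral_congr_ae (g.measurableSet_cell n) ?_
  filter_upwards [hE.ae_eq hσ (memLp_regionCurrent (g.measurableSet_cell m)
    (g.volume_cell_ne_top m) β) hE', e', g.ae_notMem_closure_cell h] with P h1 h2 h3 hP
  rw [h1]
  exact (h2 (h3 hP) α).2

/-- Mirrors through pairs of points do not respect boxes, and on overlapping boxes the kernel
integral is singular. Boxes with different `x` index are handled by the pointwise symmetry of the
kernel, boxes with the same one by parity in `x`. -/
lemma IsLossyGalerkinMatrix.entry_symm (hσ : IsDissipative σ) (hS : S.Finite)
    (hG : IsLossyGreenTensor σ S ω μ₀ G) (hB : IsLossyGalerkinMatrix σ ω μ₀ g B)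
    (n m : CellIndex Nx Ny Nz) : B n m 0 1 = B n m 1 0 := by
  by_cases h : n.1 = m.1
  · obtain ⟨a, q⟩ := n
    obtain ⟨d, r⟩ := m
    obtain rfl : a = d := h
    -- The mirror in the common midplane preserves both boxes and reverses the sign of the `xy` and
    -- `yx` entries, so both vanish.
    have h1 := hB.entry_mirrorX hσ a a a a q r 0 1 rfl
    have h2 := hB.entry_mirrorX hσ a a a a q r 1 0 rfl
    simp only [signX, Fin.isValue, Matrix.cons_val_zero, Matrix.cons_val_one] at h1 h2
    linear_combination h1 / 2 - h2 / 2
  · rw [hB.eq_integral_kernel hσ hG h, hB.eq_integral_kernel hσ hG h]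
    refine setIntegral_congr_ae (g.measurableSet_cell n) ?_
    filter_upwards [ae_coord_notMem 2 hS, g.ae_notMem_closure_cell h] with P h1 h2 hP
    refine setIntegral_congr_ae (g.measurableSet_cell m) ?_
    filter_upwards [ae_coord_notMem 2 hS] with P₀ h3 hP₀
    exact hG.entry_symm hσ hS ⟨fun e => h2 hP (subset_closure (e ▸ hP₀)), h1, h3⟩

lemma IsLossyGalerkinMatrix.galerkinSymmetry (hσ : IsDissipative σ) (hS : S.Finite)
    (hG : IsLossyGreenTensor σ S ω μ₀ G) (hB : IsLossyGalerkinMatrix σ ω μ₀ g B) :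
    GalerkinSymmetry B where
  reciprocity n m := (hB.isResponse n m).reciprocity hσ (g.measurableSet_cell _)
    (g.volume_cell_ne_top _) (g.measurableSet_cell _) (g.volume_cell_ne_top _) (hB.isResponse m n)
  mirrorX := hB.entry_mirrorX hσ
  mirrorY := hB.entry_mirrorY hσ
  entry_symm := hB.entry_symm hσ hS hG

lemma GalerkinSymmetry.of_tendsto {Bε : ℝ → CellIndex Nx Ny Nz → CellIndex Nx Ny Nz → Tensor}
    {l : Filter ℝ} [l.NeBot] (h : ∀ᶠ ε in l, GalerkinSymmetry (Bε ε))
    (hlim : ∀ n m, Tendsto (fun ε => Bε ε n m) l (𝓝 (B n m))) : GalerkinSymmetry B := by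
  have hl : ∀ n m α β, Tendsto (fun ε => Bε ε n m α β) l (𝓝 (B n m α β)) := fun n m α β =>
    tendsto_pi_nhds.1 (tendsto_pi_nhds.1 (hlim n m) α) β
  refine ⟨fun n m α β => ?_, fun a a' d d' q r α β e => ?_, fun b b' e e' a c d f α β k => ?_,
    fun n m => ?_⟩
  · exact tendsto_nhds_unique_of_eventuallyEq (hl _ _ _ _) (hl _ _ _ _)
      (h.mono fun ε hε => hε.reciprocity n m α β)
  · exact tendsto_nhds_unique_of_eventuallyEq (hl _ _ _ _) ((hl _ _ _ _).const_mul _)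
      (h.mono fun ε hε => hε.mirrorX a a' d d' q r α β e)
  · exact tendsto_nhds_unique_of_eventuallyEq (hl _ _ _ _) ((hl _ _ _ _).const_mul _)
      (h.mono fun ε hε => hε.mirrorY b b' e e' a c d f α β k)
  · exact tendsto_nhds_unique_of_eventuallyEq (hl _ _ _ _) (hl _ _ _ _)
      (h.mono fun ε hε => hε.entry_symm n m)

lemma LayeredMedium.IsGalerkinMatrix.galerkinSymmetry {L : LayeredMedium}
    (hG : L.IsElectricGreenTensor ω μ₀ G) (hB : L.IsGalerkinMatrix ω μ₀ g B) :
    GalerkinSymmetry B := by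
  by_cases hL : L.IsLossy
  · exact (hB.1 hL).galerkinSymmetry hL.isDissipative L.finite_interfaces (hG.1 hL)
  · obtain ⟨Gε, h1, -⟩ := hG.2 hL
    obtain ⟨Bε, h2, h3⟩ := hB.2 hL
    refine GalerkinSymmetry.of_tendsto (l := 𝓝[>] 0) ?_ h3
    filter_upwards [self_mem_nhdsWithin] with ε hε
    exact (h2 ε hε).galerkinSymmetry (L.isDissipative_add hε) L.finite_interfaces (h1 ε hε)

/-! ### Block Toeplitz structure and transpose relations. -/

namespace GalerkinSymmetry

/-- Interchanging the lateral positions of two boxes. -/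
lemma lateral_swap (h : GalerkinSymmetry B) (a d : Fin Nx) (b e : Fin Ny) (c f : Fin Nz)
    (α β : Fin 3) : B (d, e, c) (a, b, f) α β =
      signX α * signX β * (signY α * signY β) * B (a, b, c) (d, e, f) α β := by
  rw [h.mirrorX a d d a (e, c) (b, f) α β (add_comm _ _),
    h.mirrorY b e e b a c d f α β (add_comm _ _)]
  ring

/-- The discrete counterpart of `lateralForm_swap`: reciprocity exchanges the boxes, and
`lateral_swap` puts their lateral positions back. -/
lemma vertical_swap (h : GalerkinSymmetry B) (a d : Fin Nx) (b e : Fin Ny) (c f : Fin Nz)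
    (α β : Fin 3) : B (a, b, f) (d, e, c) β α =
      signX α * signX β * (signY α * signY β) * B (a, b, c) (d, e, f) α β := by
  rw [h.reciprocity, h.lateral_swap]

/-- The blocks depend on the lateral positions of the boxes only through their offsets. -/
lemma translate (h : GalerkinSymmetry B) {a d a' d' : Fin Nx} {b e b' e' : Fin Ny}
    (hx : ((a : ℕ) : ℤ) - (d : ℕ) = (a' : ℕ) - (d' : ℕ))
    (hy : ((b : ℕ) : ℤ) - (e : ℕ) = (b' : ℕ) - (e' : ℕ)) (c f : Fin Nz) :
    B (a', b', c) (d', e', f) = B (a, b, c) (d, e, f) := by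
  ext α β
  -- Equal offsets give `d + a' = a + d'`, so one mirror exchanges `d` with `a'` and `a` with `d'`.
  -- This leads to the pair with lateral positions interchanged, which `lateral_swap` undoes; all
  -- signs are squared.
  rw [h.mirrorX d a' a d' (b', c) (e', f) α β (by omega),
    h.mirrorY e b' b e' d c a f α β (by omega), h.lateral_swap a d b e c f]
  linear_combination (B (a, b, c) (d, e, f) α β) *
    (signY α * signY α * signY β * signY β * signX α * signX α * signX_mul_self β +
      signY α * signY α * signY β * signY β * signX_mul_self α +
      signY α * signY α * signY_mul_self β + signY_mul_self α)

open Classical in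
/-- The vertical blocks of a Galerkin matrix at the lateral offsets `i` (in `y`) and `j`
(in `x`). -/
def verticalBlock (B : CellIndex Nx Ny Nz → CellIndex Nx Ny Nz → Tensor) (i j : ℤ)
    (α β : Fin 3) : Matrix (Fin Nz) (Fin Nz) ℂ :=
  if h : ∃ p : (Fin Nx × Fin Ny) × (Fin Nx × Fin Ny),
      ((p.1.2 : ℕ) : ℤ) - (p.2.2 : ℕ) = i ∧ ((p.1.1 : ℕ) : ℤ) - (p.2.1 : ℕ) = j then
    -- The representative pair depends on the offsets alone, not on `α`, `β`, so relations between
    -- components can be read off from one pair of positions.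
    Matrix.of fun k l => B (h.choose.1.1, h.choose.1.2, k) (h.choose.2.1, h.choose.2.2, l) α β
  -- Offsets that no pair of boxes realizes; the transpose relations hold trivially there.
  else 0

lemma isBlockForm (h : GalerkinSymmetry B) : IsBlockForm B (verticalBlock B) := by
  rintro ⟨a, b, c⟩ ⟨d, e, f⟩ α β
  have hex : ∃ p : (Fin Nx × Fin Ny) × (Fin Nx × Fin Ny),
      ((p.1.2 : ℕ) : ℤ) - (p.2.2 : ℕ) = (b : ℕ) - (e : ℕ) ∧
        ((p.1.1 : ℕ) : ℤ) - (p.2.1 : ℕ) = (a : ℕ) - (d : ℕ) := ⟨((a, b), (d, e)), rfl, rfl⟩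
  rw [verticalBlock, dif_pos hex, Matrix.of_apply]
  exact congrFun (congrFun (h.translate hex.choose_spec.2 hex.choose_spec.1 c f) α) β

lemma verticalBlock_transpose (h : GalerkinSymmetry B) (i j : ℤ) (α β : Fin 3) :
    (verticalBlock B i j β α).transpose =
      (signX α * signX β * (signY α * signY β)) • verticalBlock B i j α β := by
  unfold verticalBlock
  split_ifs with hex
  · ext k l
    exact h.vertical_swap _ _ _ _ k l α β
  · simp

lemma verticalBlock_symm (h : GalerkinSymmetry B) (i j : ℤ) :
    verticalBlock B i j 0 1 = verticalBlock B i j 1 0 := by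
  unfold verticalBlock
  split_ifs with hex
  · ext k l
    exact h.entry_symm _ _
  · rfl

end GalerkinSymmetry

end

end LayeredEM

end

theorem lemma1 (L : LayeredMedium) (ω μ₀ : ℝ) (hω : ω ≠ 0) (hμ₀ : 0 < μ₀)
    (G : Space → Space → Tensor) (hG : L.IsElectricGreenTensor ω μ₀ G) :
    -- the tensor depends on the lateral coordinates only through `x - x₀` and `y - y₀`
    (∀ x y z x₀ y₀ z₀ : ℝ, L.RegularPair !₂[x, y, z] !₂[x₀, y₀, z₀] →
      G !₂[x, y, z] !₂[x₀, y₀, z₀] = lateralForm G (x - x₀) (y - y₀) z z₀) ∧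
    -- symmetry and antisymmetry under the swap of the vertical coordinates
    (∀ x y z x₀ y₀ z₀ : ℝ, L.RegularPair !₂[x, y, z] !₂[x₀, y₀, z₀] →
      lateralForm G (x - x₀) (y - y₀) z z₀ 0 0 = lateralForm G (x - x₀) (y - y₀) z₀ z 0 0 ∧
      lateralForm G (x - x₀) (y - y₀) z z₀ 1 1 = lateralForm G (x - x₀) (y - y₀) z₀ z 1 1 ∧
      lateralForm G (x - x₀) (y - y₀) z z₀ 2 2 = lateralForm G (x - x₀) (y - y₀) z₀ z 2 2 ∧
      lateralForm G (x - x₀) (y - y₀) z z₀ 0 1 = lateralForm G (x - x₀) (y - y₀) z z₀ 1 0 ∧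
      lateralForm G (x - x₀) (y - y₀) z z₀ 0 1 = lateralForm G (x - x₀) (y - y₀) z₀ z 0 1 ∧
      lateralForm G (x - x₀) (y - y₀) z z₀ 2 0 = -lateralForm G (x - x₀) (y - y₀) z₀ z 0 2 ∧
      lateralForm G (x - x₀) (y - y₀) z z₀ 2 1 = -lateralForm G (x - x₀) (y - y₀) z₀ z 1 2) ∧
    -- the Galerkin matrix is block Toeplitz, and its blocks satisfy the transpose relations
    (∀ (Nx Ny Nz : ℕ) (g : Grid Nx Ny Nz)
      (B : CellIndex Nx Ny Nz → CellIndex Nx Ny Nz → Tensor), L.IsGalerkinMatrix ω μ₀ g B →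
      ∃ Q : ℤ → ℤ → Fin 3 → Fin 3 → Matrix (Fin Nz) (Fin Nz) ℂ, IsBlockForm B Q ∧
        ∀ i j : ℤ, |i| < (Ny : ℤ) → |j| < (Nx : ℤ) →
          Q i j 2 0 = -(Q i j 0 2).transpose ∧
          Q i j 2 1 = -(Q i j 1 2).transpose ∧
          Q i j 0 0 = (Q i j 0 0).transpose ∧
          Q i j 1 1 = (Q i j 1 1).transpose ∧
          Q i j 2 2 = (Q i j 2 2).transpose ∧
          Q i j 0 1 = (Q i j 0 1).transpose ∧
          Q i j 0 1 = Q i j 1 0 ∧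
          Q i j 0 1 = (Q i j 1 0).transpose) := by
  refine ⟨fun x y z x₀ y₀ z₀ h => hG.eq_lateralForm h, fun x y z x₀ y₀ z₀ h => ?_,
    fun Nx Ny Nz g B hB => ?_⟩
  · have hl := h.lateral
    have hs := hl.swap
    have key := hG.lateralForm_swap hl
    have k00 := key 0 0
    have k11 := key 1 1
    have k22 := key 2 2
    have k01 := key 0 1
    have k20 := key 2 0
    have k21 := key 2 1
    have e1 : lateralForm G (x - x₀) (y - y₀) z z₀ 0 1 =
      lateralForm G (x - x₀) (y - y₀) z z₀ 1 0 := hG.entry_symm hl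
    -- The height swap also transposes the indices; the `xy` symmetry at the swapped heights undoes
    -- the transposition.
    have e2 : lateralForm G (x - x₀) (y - y₀) z₀ z 0 1 =
      lateralForm G (x - x₀) (y - y₀) z₀ z 1 0 := hG.entry_symm hs
    simp only [VerticalMirror.signX, VerticalMirror.signY, Fin.isValue, Matrix.cons_val_zero,
      Matrix.cons_val_one, Matrix.cons_val, mul_one, mul_neg, neg_neg, one_mul, neg_mul]
      at k00 k11 k22 k01 k20 k21
    exact ⟨k00.symm, k11.symm, k22.symm, e1, by rw [e2, k01], by rw [k20, neg_neg],
      by rw [k21, neg_neg]⟩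
  · have hS := hB.galerkinSymmetry hG
    refine ⟨GalerkinSymmetry.verticalBlock B, hS.isBlockForm, fun i j _ _ => ?_⟩
    have key := hS.verticalBlock_transpose i j
    have k00 := key 0 0
    have k11 := key 1 1
    have k22 := key 2 2
    have k01 := key 0 1
    have k20 := key 2 0
    have k21 := key 2 1
    have e := hS.verticalBlock_symm i j
    simp only [VerticalMirror.signX, VerticalMirror.signY, Fin.isValue, Matrix.cons_val_zero,
      Matrix.cons_val_one, Matrix.cons_val, mul_one, mul_neg, neg_neg,
      neg_smul, one_smul] at k00 k11 k22 k01 k20 k21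
    exact ⟨by rw [k20, neg_neg], by rw [k21, neg_neg], k00.symm, k11.symm, k22.symm,
      by rw [e, k01, e], e, k01.symm⟩
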